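/- Let $R$ be an excellent discrete valuation ring and $S=\operatorname{Spec}R$. Let $\mathcal C_S$ be the category of schemes separated and of finite type over $S$. Say that $X\in\mathcal C_S$ with structure morphism $\pi$ is of (pure) dimension $d$, with image of dimension $r$, if for every generic point $x$ of $X$ the closure of $\pi(x)$ in $S$ has Krull dimension $r$ and $d=\operatorname{trdeg}(\kappa(x)/\kappa(\pi(x)))+r$. Fix a function $\tau:\mathbb N\to\mathbb Z$ normalising twists (the choice $\tau(r)=r$ gives the twist $d-\dim\pi(X)$ below). A homology theory with duality $(H_*,H^*)$ on $\mathcal C_S$ consists of the following. * A homology theory: abelian groups $H_a(X,n)$ ($a,n\in\mathbb Z$, $X\in\mathcal C_S$), covariant for proper morphisms and contravariant for étale morphisms, with long exact localization sequences $\dots\to H_a(Y,n)\to H_a(X,n)\to H_a(X\setminus Y,n)\xrightarrow{\partial}H_{a-1}(Y,n)\to\dots$ for closed immersions $Y\hookrightarrow X$, functorial for proper morphisms and open immersions $X'\to X$ (with $Y'=Y\times_XX'$). * A cohomology theory with supports: abelian groups $H^a_Y(X,n)$ for closed immersions $Y\hookrightarrow X$ in $\mathcal C_S$, contravariant for cartesian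 squares, with long exact localization sequences $\dots\to H^a_Z(X,n)\to H^a_Y(X,n)\to H^a_{Y\setminus Z}(X\setminus Z,n)\to H^{a+1}_Z(X,n)\to\dots$ for closed immersions $Z\hookrightarrow Y\hookrightarrow X$, compatible with pullbacks, and satisfying excision: $H^a_Y(X,n)\cong H^a_Y(U,n)$ by restriction if $U\subset X$ is open and contains $Y$. * Biadditive pairings $\cap: H_i(X,m)\times H^j_Y(X,n)\to H_{i-j}(Y,m-n)$ such that, for a cartesian square with vertical maps $f_X:X'\to X$ and $f_Y:Y'\to Y$: if $f_X$ is étale, then $f_X^*z\cap f_X^*a=f_Y^*(z\cap a)$; if $f_X$ is proper, then $f_{X*}(z)\cap a=f_{Y*}(z\cap f_X^*a)$. * Fundamental classes $\eta_X\in H_{2d}(X,d-\tau(r))$ for $X$ of dimension $d$ with image of dimension $r$, such that $\alpha^*\eta_X=\eta_{X'}$ for étale $\alpha:X'\to X$. * Poincaré duality: if moreover $X$ is regular and $Y\hookrightarrow X$ is a closed immersion, then $\eta_X\cap-:H^{j}_Y(X,n)\to H_{2d-j}(Y,d-\tau(r)-n)$ is an isomorphism for all $j,n$. Assume that $(H_*,H^*)$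 satisfies principal triviality: for every $\pi:X\to S$ in $\mathcal C_S$ and every principal (effective Cartier) divisor $i:W\hookrightarrow X$ such that $W$ is of dimension $d$ and is smooth (in particular flat) over the reduced closure of $\pi(X)$ in $S$, one has $i_*\eta_W=0$ in $H_{2d}(X,d-\tau(\dim\pi(X)))$, where $\dim\pi(X)$ is the Krull dimension of the closure of $\pi(X)$ and $\eta_W$ is the fundamental class for the image dimension $\dim\pi(X)$. (This holds in particular if $i_*:H_{2d}(W,d-\tau(\dim\pi(X)))\to H_{2d}(X,d-\tau(\dim\pi(X)))$ is zero for all such $i$.) Let $i:Z_1\hookrightarrow Z_2$ be a closed immersion of affine schemes in $\mathcal C_S$ and $p:Z_2\to Z_1$ a morphism in $\mathcal C_S$ with $p\circ i=\mathrm{id}_{Z_1}$. Let $T$ be a finite set of points of $Z_2$ such that $p$ is smooth of relative dimension $1$ at every point of $T$. Then $i$ is homologically effaceable at $T$: there is an open subset $U\subset Z_2$ containing $T$ such that for all $a,n\in\mathbb Z$ the composition $$H_a(Z_1,n)\xrightarrow{i_*}H_a(Z_2,n)\to H_a(U,n)$$ is zero. -/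

import Mathlib

universe u w w'

open CategoryTheory AlgebraicGeometry TopologicalSpace

namespace BlochOgus

noncomputable section

/-! ### Excellent rings -/

/-- A ring is catenary if any two saturated chains of primes with the same end points have the same
length. (Only used for Noetherian rings, in which saturated chains exist between `p ≤ q`.) -/
def IsCatenaryRing (A : Type u) [CommRing A] : Prop :=
  ∀ c d : RelSeries {q : PrimeSpectrum A × PrimeSpectrum A | q.1 ⋖ q.2},
    c.head = d.head → c.last = d.last → c.length = d.length

/-- The formal fibres of a Noetherian local ring `A` are geometrically regular: for every prime `q`
of `A` and every finite extension `L` of `κ(q)`, the ring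
`L ⊗ Â = L ⊗_{κ(q)} (κ(q) ⊗ Â)` is regular. -/
def HasGeometricallyRegularFormalFibres (A : Type u) [CommRing A] [IsLocalRing A] : Prop :=
  ∀ (q : Ideal A) [q.IsPrime] (L : Type u) [Field L] [Algebra q.ResidueField L] [Algebra A L]
    [IsScalarTower A q.ResidueField L] [FiniteDimensional q.ResidueField L],
    IsRegularRing (TensorProduct A L (AdicCompletion (IsLocalRing.maximalIdeal A) A))

/-- Excellent rings: Noetherian, universally catenary, G-ring and J-2. -/
structure IsExcellentRing (R : Type u) [CommRing R] : Prop where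
  noetherian : IsNoetherianRing R
  universally_catenary : ∀ (A : Type u) [CommRing A] [Algebra R A], Algebra.FiniteType R A →
    IsCatenaryRing A
  gring : ∀ (p : Ideal R) [p.IsPrime],
    HasGeometricallyRegularFormalFibres (Localization.AtPrime p)
  jtwo : ∀ (A : Type u) [CommRing A] [Algebra R A], Algebra.FiniteType R A →
    IsOpen {p : PrimeSpectrum A | IsRegularLocalRing (Localization.AtPrime p.asIdeal)}

/-! ### Schemes separated and of finite type over `S` -/

/-- The category of schemes separated and of finite type over `S`
(morphisms are the morphisms over `S`). -/
abbrev FTSch (S : Scheme.{u}) : Type (u + 1) :=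
  ObjectProperty.FullSubcategory (fun X : Over S =>
    IsSeparated X.hom ∧ LocallyOfFiniteType X.hom ∧ QuasiCompact X.hom)

variable {S : Scheme.{u}}

/-- The underlying scheme. -/
abbrev FTSch.sch (X : FTSch S) : Scheme.{u} := X.obj.left

/-- The structure morphism. -/
abbrev FTSch.str (X : FTSch S) : X.sch ⟶ S := X.obj.hom

/-- The morphism of schemes underlying a morphism over `S`. -/
abbrev mor {X Y : FTSch S} (f : X ⟶ Y) : X.sch ⟶ Y.sch := f.hom.left

/-- The transcendence degree of `κ(x)` over `κ(π(x))`, where `π : X ⟶ S` is the structure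
morphism. -/
def residueTrdeg (X : FTSch S) (x : X.sch) : Cardinal.{u} :=
  letI := (X.str.residueFieldMap x).hom.toAlgebra
  Algebra.trdeg (S.residueField (X.str x)) (X.sch.residueField x)

/-- `X` is purely of dimension `d`, and the closure of its image in `S` is purely of dimension `r`:
every generic point `x` of (an irreducible component of) `X` lies over a point of `S` whose closure
has Krull dimension `r`, and `d = trdeg(κ(x) / κ(π(x))) + r`.

This is the usual dimension of schemes of finite type over a one-dimensional base `S`; it is
invariant under étale morphisms (an open subscheme of the generic fibre of `X` has the same
dimension as `X`). -/
def HasPureDim (X : FTSch S) (d r : ℕ) : Prop :=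
  ∀ x : X.sch, closure {x} ∈ irreducibleComponents X.sch →
    topologicalKrullDim (closure ({X.str x} : Set S)) = r ∧
    ∃ t : ℕ, residueTrdeg X x = t ∧ d = t + r

/-- All local rings of `X` are regular. -/
def IsRegularSch (X : FTSch S) : Prop :=
  ∀ x : X.sch, IsRegularLocalRing (X.sch.presheaf.stalk x)

/-! ### Homology theories -/

/-- A closed immersion `i : Y ⟶ X` together with its open complement `j : V ⟶ X`. -/
structure ClosedOpen (S : Scheme.{u}) where
  {Y X V : FTSch S}
  i : Y ⟶ X
  j : V ⟶ X
  closed : IsClosedImmersion (mor i)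
  isOpen : IsOpenImmersion (mor j)
  compl : Set.range (mor j) = (Set.range (mor i))ᶜ

instance (L : ClosedOpen S) : IsClosedImmersion (mor L.i) := L.closed
instance (L : ClosedOpen S) : IsOpenImmersion (mor L.j) := L.isOpen

/-- A morphism `f : L'.X ⟶ L.X` such that `L'` is the preimage of `L` under `f`. -/
structure ClosedOpen.Map (L' L : ClosedOpen S) where
  f : L'.X ⟶ L.X
  fY : L'.Y ⟶ L.Y
  fV : L'.V ⟶ L.V
  isPullback_Y : IsPullback (mor fY) (mor L'.i) (mor L.i) (mor f)
  isPullback_V : IsPullback (mor fV) (mor L'.j) (mor L.j) (mor f)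

/-- A homology theory `H_a(-, n)`, for all twists `n`. -/
structure HomologyTheory (S : Scheme.{u}) where
  /-- `H a n X` is the group `H_a(X, n)`. -/
  H : ℤ → ℤ → FTSch S → Type w
  [grp : ∀ a n X, AddCommGroup (H a n X)]
  /-- Covariance for proper morphisms. -/
  push {X Y : FTSch S} (f : X ⟶ Y) (hf : IsProper (mor f)) (a n : ℤ) : H a n X →+ H a n Y
  push_id (X : FTSch S) (hf : IsProper (mor (𝟙 X))) (a n : ℤ) (z : H a n X) :
    push (𝟙 X) hf a n z = z
  push_comp {X Y Z : FTSch S} (f : X ⟶ Y) (g : Y ⟶ Z) (hf : IsProper (mor f))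
    (hg : IsProper (mor g)) (hfg : IsProper (mor (f ≫ g))) (a n : ℤ) (z : H a n X) :
    push (f ≫ g) hfg a n z = push g hg a n (push f hf a n z)
  /-- Contravariance for étale morphisms. -/
  res {V X : FTSch S} (j : V ⟶ X) (hj : Etale (mor j)) (a n : ℤ) : H a n X →+ H a n V
  res_id (X : FTSch S) (hj : Etale (mor (𝟙 X))) (a n : ℤ) (z : H a n X) :
    res (𝟙 X) hj a n z = z
  res_comp {X Y Z : FTSch S} (f : X ⟶ Y) (g : Y ⟶ Z) (hf : Etale (mor f))
    (hg : Etale (mor g)) (hfg : Etale (mor (f ≫ g))) (a n : ℤ) (z : H a n Z) :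
    res (f ≫ g) hfg a n z = res f hf a n (res g hg a n z)
  /-- The boundary map of the localization sequence. -/
  bdry (L : ClosedOpen S) (a n : ℤ) : H (a + 1) n L.V →+ H a n L.Y
  exact_push_res (L : ClosedOpen S) (a n : ℤ) :
    Function.Exact (push L.i inferInstance a n) (res L.j inferInstance a n)
  exact_res_bdry (L : ClosedOpen S) (a n : ℤ) :
    Function.Exact (res L.j inferInstance (a + 1) n) (bdry L a n)
  exact_bdry_push (L : ClosedOpen S) (a n : ℤ) :
    Function.Exact (bdry L a n) (push L.i inferInstance a n)
  /-- Functoriality of the localization sequence for proper morphisms. -/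
  res_push {L' L : ClosedOpen S} (φ : L'.Map L) (hf : IsProper (mor φ.f))
    (hV : IsProper (mor φ.fV)) (a n : ℤ) (z : H a n L'.X) :
    res L.j inferInstance a n (push φ.f hf a n z) =
      push φ.fV hV a n (res L'.j inferInstance a n z)
  bdry_push {L' L : ClosedOpen S} (φ : L'.Map L) (_ : IsProper (mor φ.f))
    (hV : IsProper (mor φ.fV)) (hY : IsProper (mor φ.fY)) (a n : ℤ) (z : H (a + 1) n L'.V) :
    bdry L a n (push φ.fV hV (a + 1) n z) = push φ.fY hY a n (bdry L' a n z)
  /-- Functoriality of the localization sequence for open immersions. -/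
  push_res {L' L : ClosedOpen S} (φ : L'.Map L) (_ : IsOpenImmersion (mor φ.f))
    (hf : Etale (mor φ.f)) (hY : Etale (mor φ.fY)) (a n : ℤ) (z : H a n L.Y) :
    res φ.f hf a n (push L.i inferInstance a n z) =
      push L'.i inferInstance a n (res φ.fY hY a n z)
  bdry_res {L' L : ClosedOpen S} (φ : L'.Map L) (_ : IsOpenImmersion (mor φ.f))
    (hV : Etale (mor φ.fV)) (hY : Etale (mor φ.fY)) (a n : ℤ) (z : H (a + 1) n L.V) :
    bdry L' a n (res φ.fV hV (a + 1) n z) = res φ.fY hY a n (bdry L a n z)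

attribute [instance] HomologyTheory.grp

/-! ### Cohomology theories with supports -/

/-- A closed immersion `i : Y ⟶ X`. -/
structure ClosedPair (S : Scheme.{u}) where
  {Y X : FTSch S}
  i : Y ⟶ X
  closed : IsClosedImmersion (mor i)

instance (P : ClosedPair S) : IsClosedImmersion (mor P.i) := P.closed

/-- A cartesian square from the closed immersion `P'` to the closed immersion `P`. -/
structure CartSq (P' P : ClosedPair S) where
  fX : P'.X ⟶ P.X
  fY : P'.Y ⟶ P.Y
  isPullback : IsPullback (mor fY) (mor P'.i) (mor P.i) (mor fX)

/-- Closed immersions `Z ⟶ Y ⟶ X`. -/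
structure ClosedTriple (S : Scheme.{u}) where
  {Z Y X : FTSch S}
  k : Z ⟶ Y
  i : Y ⟶ X
  closed_k : IsClosedImmersion (mor k)
  closed_i : IsClosedImmersion (mor i)

/-- The closed immersion `Z ⟶ X`. -/
def ClosedTriple.small (T : ClosedTriple S) : ClosedPair S where
  i := T.k ≫ T.i
  closed := by
    have := T.closed_k
    have := T.closed_i
    exact inferInstanceAs (IsClosedImmersion (mor T.k ≫ mor T.i))

/-- The closed immersion `Y ⟶ X`. -/
def ClosedTriple.big (T : ClosedTriple S) : ClosedPair S where
  i := T.i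
  closed := T.closed_i

/-- The closed immersion `Y - Z ⟶ X - Z`, as a cartesian square over `Y ⟶ X`. -/
structure ClosedTriple.Compl (T : ClosedTriple S) where
  P : ClosedPair S
  sq : CartSq P T.big
  isOpen : IsOpenImmersion (mor sq.fX)
  compl : Set.range (mor sq.fX) = (Set.range (mor T.small.i))ᶜ

/-- A cohomology theory with supports. -/
structure CohomologyTheory (S : Scheme.{u}) where
  /-- `H a n P` is the group `H^a_Y(X, n)`, for the closed immersion `P = (Y ⟶ X)`. -/
  H : ℤ → ℤ → ClosedPair S → Type w
  [grp : ∀ a n P, AddCommGroup (H a n P)]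
  /-- Contravariance for cartesian squares. -/
  pull {P' P : ClosedPair S} (φ : CartSq P' P) (a n : ℤ) : H a n P →+ H a n P'
  pull_id {P : ClosedPair S} (φ : CartSq P P) (_ : φ.fX = 𝟙 P.X) (_ : φ.fY = 𝟙 P.Y) (a n : ℤ)
    (z : H a n P) : pull φ a n z = z
  pull_comp {P'' P' P : ClosedPair S} (φ : CartSq P'' P') (ψ : CartSq P' P) (χ : CartSq P'' P)
    (_ : χ.fX = φ.fX ≫ ψ.fX) (_ : χ.fY = φ.fY ≫ ψ.fY) (a n : ℤ) (z : H a n P) :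
    pull χ a n z = pull φ a n (pull ψ a n z)
  /-- Enlarging the support, `H^a_Z(X, n) → H^a_Y(X, n)`. -/
  ext (T : ClosedTriple S) (a n : ℤ) : H a n T.small →+ H a n T.big
  /-- The boundary map `H^a_{Y-Z}(X-Z, n) → H^{a+1}_Z(X, n)`. -/
  bdry (T : ClosedTriple S) (C : T.Compl) (a n : ℤ) : H a n C.P →+ H (a + 1) n T.small
  exact_ext_pull (T : ClosedTriple S) (C : T.Compl) (a n : ℤ) :
    Function.Exact (ext T a n) (pull C.sq a n)
  exact_pull_bdry (T : ClosedTriple S) (C : T.Compl) (a n : ℤ) :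
    Function.Exact (pull C.sq a n) (bdry T C a n)
  exact_bdry_ext (T : ClosedTriple S) (C : T.Compl) (a n : ℤ) :
    Function.Exact (bdry T C a n) (ext T (a + 1) n)
  /-- Compatibility of the localization sequence with pullbacks. -/
  ext_pull {T' T : ClosedTriple S} (φ : CartSq T'.small T.small) (ψ : CartSq T'.big T.big)
    (_ : φ.fX = ψ.fX) (a n : ℤ) (z : H a n T.small) :
    ext T' a n (pull φ a n z) = pull ψ a n (ext T a n z)
  bdry_pull {T' T : ClosedTriple S} (C' : T'.Compl) (C : T.Compl)
    (φ : CartSq T'.small T.small) (ψ : CartSq T'.big T.big) (χ : CartSq C'.P C.P)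
    (_ : φ.fX = ψ.fX) (_ : χ.fX ≫ C.sq.fX = C'.sq.fX ≫ φ.fX) (a n : ℤ) (z : H a n C.P) :
    bdry T' C' a n (pull χ a n z) = pull φ (a + 1) n (bdry T C a n z)
  /-- Excision. -/
  excision {P' P : ClosedPair S} (φ : CartSq P' P) (_ : IsOpenImmersion (mor φ.fX))
    (_ : Set.range (mor P.i) ⊆ Set.range (mor φ.fX)) (a n : ℤ) :
    Function.Bijective (pull φ a n)

attribute [instance] CohomologyTheory.grp

/-! ### Homology theories with duality -/

/-- A homology theory with duality.

The function `τ` normalises the twist of fundamental classes: if `X` is of dimension `d` and the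
closure of its image in `S` is of dimension `r`, then `η_X ∈ H_{2d}(X, d - τ r)`. The choice `τ r = r`
gives the twist `d - dim π(X)`; the constant function `τ = dim S` gives the normalisation of étale
homology defined by `π^!` and Tate twists. -/
structure DualityTheory (S : Scheme.{u}) (τ : ℕ → ℤ) where
  hom : HomologyTheory.{u, w} S
  coh : CohomologyTheory.{u, w'} S
  /-- The cup product with supports `H_i(X, m) × H^j_Y(X, n) → H_{i-j}(Y, m-n)`. -/
  cap (P : ClosedPair S) (i m j n : ℤ) :
    hom.H i m P.X →+ coh.H j n P →+ hom.H (i - j) (m - n) P.Y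
  /-- Compatibility of the cup product with restriction along étale morphisms. -/
  cap_res {P' P : ClosedPair S} (φ : CartSq P' P) (hX : Etale (mor φ.fX)) (hY : Etale (mor φ.fY))
    (i m j n : ℤ) (z : hom.H i m P.X) (a : coh.H j n P) :
    cap P' i m j n (hom.res φ.fX hX i m z) (coh.pull φ j n a) =
      hom.res φ.fY hY (i - j) (m - n) (cap P i m j n z a)
  /-- The projection formula for proper morphisms. -/
  projection {P' P : ClosedPair S} (φ : CartSq P' P) (hX : IsProper (mor φ.fX))
    (hY : IsProper (mor φ.fY)) (i m j n : ℤ) (z : hom.H i m P'.X) (a : coh.H j n P) :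
    cap P i m j n (hom.push φ.fX hX i m z) a =
      hom.push φ.fY hY (i - j) (m - n) (cap P' i m j n z (coh.pull φ j n a))
  /-- The fundamental class. -/
  fund (X : FTSch S) (d r : ℕ) (hX : HasPureDim X d r) : hom.H (2 * (d : ℤ)) ((d : ℤ) - τ r) X
  fund_res {X' X : FTSch S} (f : X' ⟶ X) (hf : Etale (mor f)) (d r : ℕ)
    (hX : HasPureDim X d r) (hX' : HasPureDim X' d r) :
    hom.res f hf _ _ (fund X d r hX) = fund X' d r hX'
  /-- Poincaré duality. -/
  duality (P : ClosedPair S) (d r : ℕ) (hX : HasPureDim P.X d r) (_ : IsRegularSch P.X)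
    (j n : ℤ) :
    Function.Bijective (cap P (2 * (d : ℤ)) ((d : ℤ) - τ r) j n (fund P.X d r hX))

/-- The closed immersion `P = (W ⟶ X)` is a principal divisor: there is a global section `t` of
`𝒪_X`, a nonzerodivisor on every affine open, that generates the ideal sheaf of `W`. -/
def IsPrincipalDivisor (P : ClosedPair S) : Prop :=
  ∃ t : Γ(P.X.sch, ⊤), ∀ U : P.X.sch.affineOpens,
    P.X.sch.presheaf.map (homOfLE le_top).op t ∈ nonZeroDivisors Γ(P.X.sch, U) ∧
    (mor P.i).ker.ideal U = Ideal.span {P.X.sch.presheaf.map (homOfLE le_top).op t}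

/-- The closure of the image `π(X)` in `S`. -/
def imageClosure (X : FTSch S) : Closeds S := ⟨closure (Set.range X.str), isClosed_closure⟩

/-- `W` is smooth over the closure of `π(X)`, as a reduced closed subscheme of `S`. -/
def SmoothOverImage (W X : FTSch S) : Prop :=
  ∃ q : W.sch ⟶ (Scheme.IdealSheafData.vanishingIdeal (imageClosure X)).subscheme,
    Smooth q ∧ q ≫ (Scheme.IdealSheafData.vanishingIdeal (imageClosure X)).subschemeι = W.str

/-- Principal triviality: `i_* η_W = 0` in `H_{2d}(X, d - τ(dim π(X)))` for every principal
divisor `i : W ⟶ X` that is smooth (hence flat) over the image of `X` and of dimension `d`.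
This is in particular the case if `i_*` vanishes on the whole group `H_{2d}(W, d - τ(dim π(X)))`. -/
def DualityTheory.PrincipalTriviality {τ : ℕ → ℤ} (D : DualityTheory.{u, w, w'} S τ) : Prop :=
  ∀ (P : ClosedPair S) (d r : ℕ) (hW : HasPureDim P.Y d r),
    topologicalKrullDim (imageClosure P.X) = r → IsPrincipalDivisor P →
    SmoothOverImage P.Y P.X →
    D.hom.push P.i inferInstance _ _ (D.fund P.Y d r hW) = 0

/-! ### Effaceability -/

/-- `f` is smooth of relative dimension `n` at the point `x`. -/
def SmoothAtOfRelativeDimension {X Y : Scheme.{u}} (n : ℕ) (f : X ⟶ Y) (x : X) : Prop :=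
  ∃ U : X.Opens, x ∈ U ∧ SmoothOfRelativeDimension n (U.ι ≫ f)

/-- The proper morphism `f : Z₁ ⟶ Z₂` is homologically effaceable at the set of points `T` of `Z₂`:
there is an open neighbourhood `U` of `T` in `Z₂` such that
`H_a(Z₁, n) → H_a(Z₂, n) → H_a(U, n)` is zero for all `a` and `n`. -/
def HomologyTheory.EffaceableAt (H : HomologyTheory.{u, w} S) {Z₁ Z₂ : FTSch S} (f : Z₁ ⟶ Z₂)
    [IsProper (mor f)] (T : Set Z₂.sch) : Prop :=
  ∃ (U : FTSch S) (j : U ⟶ Z₂) (_ : IsOpenImmersion (mor j)), T ⊆ Set.range (mor j) ∧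
    ∀ (a n : ℤ) (z : H.H a n Z₁),
      H.res j inferInstance a n (H.push f inferInstance a n z) = 0

end

end BlochOgus

/-!
The statement follows, as in the work of Bloch and Ogus, from a deformation to a regular scheme.

Let `A₀ = Γ(Z₁)`, `B = Γ(Z₂)`, and embed `Z₁` as a closed subscheme of an affine space
`X₁ = Spec A` over `R`. Near `T`, the scheme `Z₂` is a smooth curve over `Z₁` with the section `i`.
In an affine space over `A₀` it is cut out by `c` equations, one less than the dimension of that
space, and one equation more cuts out the section; all equations can be lifted to polynomials over
`A` with an invertible Jacobian determinant (`exists_lift_equations`). The lifted equations define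
a scheme `X₂` over `X₁` and a principal divisor `W` in it that is étale over `X₁`
(`exists_model`), and they restrict over `Z₁` to an open subset `U` of `Z₂` that contains `T` and to
`V = Z₁ ∩ U`.

By Poincaré duality on the regular scheme `X₁`, a homology class of `Z₁` is the cap product of the
fundamental class of `X₁` with a cohomology class with supports in `Z₁`. Its restriction to `V` is
the cap product of the fundamental class of `W` with the pullback of this cohomology class. By
the projection formula, the image in the homology of `U` is the cap product with the image of the
fundamental class of `W` in the homology of `X₂` (`DualityTheory.res_push_eq_zero`). The latter is
zero by principal triviality, since `W` is smooth over `R` and, unless it is empty, dominates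
`Spec R`.

The Jacobian criterion (`etale_of_isUnit_det_pderiv`) is derived from the Jacobi-Zariski sequence.
That equations with independent gradients generate the ideal of a smooth closed subscheme near a
point (`exists_mul_mem_span_of_gradAt`) follows from the splitting of the conormal sequence and
Nakayama's lemma.
-/

namespace BlochOgus

open scoped TensorProduct

/-! ### The Jacobian criterion for étale maps -/

/-- If `T` is formally smooth over `R`, then `T` is formally étale over `S` as soon as
`T ⊗ Ω[S⁄R] → Ω[T⁄R]` is bijective: by the Jacobi-Zariski sequence both `Ω[T⁄S]` and the first
cotangent homology of `T` over `S` vanish. -/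
theorem formallyEtale_of_mapBaseChange_bijective {R S T : Type*} [CommRing R] [CommRing S]
    [CommRing T] [Algebra R S] [Algebra R T] [Algebra S T] [IsScalarTower R S T]
    [Algebra.FormallySmooth R T]
    (h : Function.Bijective (KaehlerDifferential.mapBaseChange R S T)) :
    Algebra.FormallyEtale S T where
  subsingleton_kaehlerDifferential := by
    refine subsingleton_of_forall_eq 0 fun y => ?_
    obtain ⟨x, rfl⟩ := KaehlerDifferential.map_surjective R S T y
    obtain ⟨z, rfl⟩ := h.2 x
    exact (KaehlerDifferential.exact_mapBaseChange_map R S T).apply_apply_eq_zero z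
  subsingleton_h1Cotangent := by
    refine subsingleton_of_forall_eq 0 fun y => ?_
    have h1 : Algebra.H1Cotangent.δ R S T y = 0 := by
      apply h.1
      rw [map_zero]
      exact (Algebra.H1Cotangent.exact_δ_mapBaseChange R S T).apply_apply_eq_zero y
    obtain ⟨z, rfl⟩ := (Algebra.H1Cotangent.exact_map_δ R S T y).1 h1
    rw [Subsingleton.elim z 0, map_zero]

/-- If `s i ∈ S` and `F i ∈ P` have the same image in `D`, then `D ⊗ Ω[S⁄A] → Ω[D⁄A] = D ⊗ Ω[P⁄A]`
is given, in the bases `d (s i)` and `c`, by the Jacobian matrix of `F`. -/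
theorem mapBaseChange_bijective_of_isUnit_det {A S P D ι : Type*} [CommRing A] [CommRing S]
    [CommRing P] [CommRing D] [Algebra A S] [Algebra A P] [Algebra A D] [Algebra S D] [Algebra P D]
    [IsScalarTower A S D] [IsScalarTower A P D] [Algebra.FormallyEtale P D] [Fintype ι]
    [DecidableEq ι] (b : Module.Basis ι S Ω[S⁄A]) (c : Module.Basis ι P Ω[P⁄A])
    (s : ι → S) (F : ι → P) (hb : ∀ i, b i = KaehlerDifferential.D A S (s i))
    (hs : ∀ i, algebraMap S D (s i) = algebraMap P D (F i))
    (hF : IsUnit (algebraMap P D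
      (Matrix.of fun i j => c.repr (KaehlerDifferential.D A P (F i)) j).det)) :
    Function.Bijective (KaehlerDifferential.mapBaseChange A S D) := by
  let c' : Module.Basis ι D Ω[D⁄A] :=
    (c.baseChange D).map (KaehlerDifferential.tensorKaehlerEquivOfFormallyEtale A P D)
  have hM : LinearMap.toMatrix (b.baseChange D) c' (KaehlerDifferential.mapBaseChange A S D) =
      ((algebraMap P D).mapMatrix
        (Matrix.of fun i j => c.repr (KaehlerDifferential.D A P (F i)) j)).transpose := by
    ext j i
    have : KaehlerDifferential.mapBaseChange A S D (b.baseChange D i) =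
        KaehlerDifferential.D A D (algebraMap P D (F i)) := by
      simp [hb, hs]
    rw [LinearMap.toMatrix_apply, this]
    simp [c', KaehlerDifferential.tensorKaehlerEquivOfFormallyEtale_symm_D_algebraMap,
      Module.Basis.baseChange_repr_tmul, Algebra.smul_def]
  have hdet : IsUnit (LinearMap.toMatrix (b.baseChange D) c'
      (KaehlerDifferential.mapBaseChange A S D)).det := by
    rw [hM, Matrix.det_transpose, ← RingHom.map_det]
    exact hF
  exact (LinearEquiv.ofIsUnitDet hdet).bijective

theorem etale_of_isUnit_det {A S P D ι : Type*} [CommRing A] [CommRing S]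
    [CommRing P] [CommRing D] [Algebra A S] [Algebra A P] [Algebra A D] [Algebra P D]
    [IsScalarTower A P D] [Algebra.FormallyEtale P D] [Algebra.FormallySmooth A D]
    [Algebra.FinitePresentation A D] [Algebra.FiniteType A S] [Fintype ι]
    [DecidableEq ι] (b : Module.Basis ι S Ω[S⁄A]) (c : Module.Basis ι P Ω[P⁄A])
    (φ : S →ₐ[A] D)
    (s : ι → S) (F : ι → P) (hb : ∀ i, b i = KaehlerDifferential.D A S (s i))
    (hs : ∀ i, φ (s i) = algebraMap P D (F i))
    (hF : IsUnit (algebraMap P D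
      (Matrix.of fun i j => c.repr (KaehlerDifferential.D A P (F i)) j).det)) :
    φ.toRingHom.Etale := by
  let _ : Algebra S D := φ.toRingHom.toAlgebra
  have : IsScalarTower A S D := .of_algebraMap_eq' φ.comp_algebraMap.symm
  have := formallyEtale_of_mapBaseChange_bijective
    (mapBaseChange_bijective_of_isUnit_det b c s F hb hs hF)
  exact (⟨this, .of_restrict_scalars_finitePresentation A S D⟩ : Algebra.Etale S D)

/-- The Jacobian criterion: on the open subset of affine space where the Jacobian determinant of
`F` is invertible, the endomorphism of affine space given by `F` is étale. -/
theorem etale_of_isUnit_det_pderiv {A D ι : Type*} [CommRing A] [CommRing D] [Fintype ι]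
    [DecidableEq ι] [Algebra (MvPolynomial ι A) D] (F : ι → MvPolynomial ι A)
    (h : MvPolynomial ι A) [IsLocalization.Away h D]
    (hF : IsUnit (algebraMap (MvPolynomial ι A) D
      (Matrix.of fun i j => MvPolynomial.pderiv j (F i)).det)) :
    ((algebraMap (MvPolynomial ι A) D).comp
      (MvPolynomial.aeval F : MvPolynomial ι A →ₐ[A] MvPolynomial ι A).toRingHom).Etale := by
  let _ : Algebra A D := ((algebraMap (MvPolynomial ι A) D).comp MvPolynomial.C).toAlgebra
  have : IsScalarTower A (MvPolynomial ι A) D := .of_algebraMap_eq' rfl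
  have : Algebra.FormallyEtale (MvPolynomial ι A) D := .of_isLocalization (.powers h)
  have : Algebra.FormallySmooth A D := .comp A (MvPolynomial ι A) D
  have hfp : Algebra.FinitePresentation A D :=
    have := IsLocalization.Away.finitePresentation h (S := D)
    .trans A (MvPolynomial ι A) D
  let φ : MvPolynomial ι A →ₐ[A] D :=
    (IsScalarTower.toAlgHom A (MvPolynomial ι A) D).comp (MvPolynomial.aeval F)
  refine etale_of_isUnit_det (KaehlerDifferential.mvPolynomialBasis A ι)
    (KaehlerDifferential.mvPolynomialBasis A ι) φ MvPolynomial.X F (fun i => ?_) (fun i => ?_) ?_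
  · simp
  · simp [φ]
  · simpa [KaehlerDifferential.mvPolynomialBasis_repr_apply] using hF

/-! ### Gradients and the choice of local equations -/

/-- The gradient `(∂g/∂x_j (x))_j` of a polynomial `g` at the point `x` of affine space over `A`,
with values in the residue field of `x`. Only the derivatives along the fibres over `A` are taken,
so that it depends on `g` as the differential relative to `A` does. -/
noncomputable def gradAt {A ι : Type*} [CommRing A] (x : PrimeSpectrum (MvPolynomial ι A)) :
    MvPolynomial ι A →+ (ι → x.asIdeal.ResidueField) where
  toFun g j := algebraMap _ _ (MvPolynomial.pderiv j g)
  map_zero' := by ext; simp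
  map_add' f g := by ext; simp

section

variable {A ι : Type*} [CommRing A] (x : PrimeSpectrum (MvPolynomial ι A))

theorem gradAt_apply (g : MvPolynomial ι A) (j : ι) :
    gradAt x g j = algebraMap _ x.asIdeal.ResidueField (MvPolynomial.pderiv j g) := rfl

theorem gradAt_mul (f g : MvPolynomial ι A) :
    gradAt x (f * g) = algebraMap _ x.asIdeal.ResidueField f • gradAt x g +
      algebraMap _ x.asIdeal.ResidueField g • gradAt x f := by
  ext j
  simp only [gradAt_apply, Derivation.leibniz, smul_eq_mul, map_add, map_mul, Pi.add_apply,
    Pi.smul_apply]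

theorem gradAt_mul_of_mem (f : MvPolynomial ι A) {g : MvPolynomial ι A} (hg : g ∈ x.asIdeal) :
    gradAt x (f * g) = algebraMap _ x.asIdeal.ResidueField f • gradAt x g := by
  rw [gradAt_mul, Ideal.algebraMap_residueField_eq_zero.2 hg, zero_smul, add_zero]

theorem gradAt_X [DecidableEq ι] (j : ι) : gradAt x (MvPolynomial.X j) = Pi.single j 1 := by
  ext k
  simp [gradAt_apply, MvPolynomial.pderiv_X, Pi.single_apply, apply_ite, eq_comm]

theorem gradAt_C (a : A) : gradAt x (MvPolynomial.C a) = 0 := by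
  ext k
  simp [gradAt_apply]

/-- A proper subspace misses the gradient of some element of `J`, even after multiplication by a
given function `e` that does not vanish at `x`. If `J` does not vanish at `x`, the element can
be chosen not to vanish there either. -/
theorem exists_mem_gradAt_mul_notMem [Finite ι] (J : Ideal (MvPolynomial ι A))
    (V : Submodule x.asIdeal.ResidueField (ι → x.asIdeal.ResidueField)) (hV : V ≠ ⊤)
    (hJ : J ≤ x.asIdeal → Submodule.span x.asIdeal.ResidueField (gradAt x '' J) = ⊤)
    {e : MvPolynomial ι A} (he : e ∉ x.asIdeal) :
    ∃ s ∈ J, gradAt x (e * s) ∉ V ∧ (J ≤ x.asIdeal ∨ s ∉ x.asIdeal) := by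
  classical
  by_cases h : J ≤ x.asIdeal
  · obtain ⟨s, hs, hsV⟩ : ∃ s ∈ J, gradAt x s ∉ V := by
      by_contra! H
      refine hV (top_le_iff.1 ((hJ h).symm.le.trans (Submodule.span_le.2 ?_)))
      rintro _ ⟨s, hs, rfl⟩
      exact H s hs
    refine ⟨s, hs, ?_, .inl h⟩
    rw [gradAt_mul_of_mem x e (h hs)]
    rwa [V.smul_mem_iff]
    rwa [Ne, Ideal.algebraMap_residueField_eq_zero]
  · obtain ⟨δ, hδ, hδx⟩ := SetLike.not_le_iff_exists.1 h
    by_cases hu : gradAt x (e * δ) ∈ V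
    · obtain ⟨j, hj⟩ : ∃ j, (Pi.single j 1 : ι → x.asIdeal.ResidueField) ∉ V := by
        by_contra! H
        refine hV (top_le_iff.1 ?_)
        rw [← (Pi.basisFun x.asIdeal.ResidueField ι).span_eq, Submodule.span_le]
        rintro _ ⟨j, rfl⟩
        simpa using H j
      -- a coordinate in the direction `j`, translated so as not to vanish at `x`
      obtain ⟨g, hgx, hg⟩ : ∃ g, g ∉ x.asIdeal ∧ gradAt x g = Pi.single j 1 := by
        by_cases hX : MvPolynomial.X j ∈ x.asIdeal
        · refine ⟨MvPolynomial.X j + 1, fun h1 => x.2.ne_top ?_, ?_⟩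
          · rw [Ideal.eq_top_iff_one]
            simpa using x.asIdeal.sub_mem h1 hX
          · rw [map_add, gradAt_X, ← MvPolynomial.C_1, gradAt_C, add_zero]
        · exact ⟨_, hX, gradAt_X x j⟩
      refine ⟨δ * g, J.mul_mem_right _ hδ, ?_, .inr fun h' => (x.2.mem_or_mem h').elim hδx hgx⟩
      rw [← mul_assoc, gradAt_mul, hg, V.add_mem_iff_left (V.smul_mem _ hu), V.smul_mem_iff]
      · exact hj
      · rw [Ne, Ideal.algebraMap_residueField_eq_zero]
        exact fun h' => (x.2.mem_or_mem h').elim he hδx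
    · exact ⟨δ, hδ, hu, .inr hδx⟩

end

/-- Among finitely many primes without inclusions, each is singled out by an element that lies in
all others. -/
theorem exists_notMem_forall_mem {P : Type*} [CommRing P] (T : Finset (PrimeSpectrum P))
    (hT : IsAntichain (· ≤ ·) (T : Set (PrimeSpectrum P))) {x : PrimeSpectrum P} (hx : x ∈ T) :
    ∃ e : P, e ∉ x.asIdeal ∧ ∀ y ∈ T, y ≠ x → e ∈ y.asIdeal := by
  classical
  have h : ¬ (T.erase x).inf (fun y => y.asIdeal) ≤ x.asIdeal := by
    rw [x.2.inf_le']
    rintro ⟨y, hy, hyx⟩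
    exact hT (Finset.mem_of_mem_erase hy) hx (Finset.ne_of_mem_erase hy) hyx
  obtain ⟨e, he, hex⟩ := SetLike.not_le_iff_exists.1 h
  exact ⟨e, hex, fun y hy hyx => (Finset.inf_le (f := fun y : PrimeSpectrum P => y.asIdeal)
    (Finset.mem_erase.2 ⟨hyx, hy⟩)) he⟩

theorem exists_notMem_forall_mul_mem {P : Type*} [CommRing P] (x : Ideal P) [x.IsPrime]
    (J K : Ideal P) (hJ : J.FG) (h : ∀ g ∈ J, ∃ s ∉ x, s * g ∈ K) :
    ∃ s ∉ x, ∀ g ∈ J, s * g ∈ K := by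
  classical
  obtain ⟨S, rfl⟩ := hJ
  choose! s hs hsg using fun g (hg : g ∈ S) => h g (Ideal.subset_span hg)
  refine ⟨∏ g ∈ S, s g, fun hp => ?_, fun g hg => ?_⟩
  · obtain ⟨g, hg, hgx⟩ := (Ideal.IsPrime.prod_mem_iff (p := x)).1 hp
    exact hs g hg hgx
  · have : Ideal.span (S : Set P) ≤ K.colon {∏ g ∈ S, s g} := by
      rw [Ideal.span_le]
      intro g hg
      rw [SetLike.mem_coe, Submodule.mem_colon_singleton, smul_eq_mul,
        ← Finset.mul_prod_erase S s hg, ← mul_assoc, mul_comm g]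
      exact K.mul_mem_right _ (hsg g hg)
    have := this hg
    rwa [Submodule.mem_colon_singleton, smul_eq_mul, mul_comm] at this

/-- Prime avoidance, for the ideals of denominators. -/
theorem exists_forall_notMem_mul_mem {P : Type*} [CommRing P] (T : Finset (PrimeSpectrum P))
    (J J' K K' : Ideal P) (hJ : J.FG) (hJ' : J'.FG)
    (h : ∀ x ∈ T, ∀ g ∈ J, ∃ s ∉ x.asIdeal, s * g ∈ K)
    (h' : ∀ x ∈ T, ∀ g ∈ J', ∃ s ∉ x.asIdeal, s * g ∈ K') :
    ∃ s : P, (∀ x ∈ T, s ∉ x.asIdeal) ∧ (∀ g ∈ J, s * g ∈ K) ∧ (∀ g ∈ J', s * g ∈ K') := by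
  -- the denominators of both inclusions form an ideal that lies in no prime of `T`
  have key : ¬ ((K.colon (J : Set P) ⊓ K'.colon (J' : Set P) : Ideal P) : Set P) ⊆
      ⋃ x ∈ (T : Set (PrimeSpectrum P)), x.asIdeal := by
    rcases T.eq_empty_or_nonempty with rfl | ⟨a, ha⟩
    · simp only [Finset.coe_empty, Set.mem_empty_iff_false, Set.iUnion_of_empty, Set.iUnion_empty]
      exact fun h0 => h0 (zero_mem (K.colon (J : Set P) ⊓ K'.colon (J' : Set P)))
    · rw [Ideal.subset_union_prime a a (fun y _ _ _ => y.2)]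
      rintro ⟨x, hx, hle⟩
      obtain ⟨s, hs, hsJ⟩ := exists_notMem_forall_mul_mem x.asIdeal J K hJ (h x hx)
      obtain ⟨s', hs', hsJ'⟩ := exists_notMem_forall_mul_mem x.asIdeal J' K' hJ' (h' x hx)
      refine (x.2.mem_or_mem (hle (x := s * s') ⟨?_, ?_⟩)).elim hs hs'
      · exact Submodule.mem_colon.2 fun g hg => by
          rw [smul_eq_mul, mul_comm s, mul_assoc]; exact K.mul_mem_left _ (hsJ g hg)
      · exact Submodule.mem_colon.2 fun g hg => by
          rw [smul_eq_mul, mul_assoc]; exact K'.mul_mem_left _ (hsJ' g hg)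
  obtain ⟨s, hs, hsT⟩ := Set.not_subset.1 key
  simp only [Set.mem_iUnion, not_exists] at hsT
  exact ⟨s, fun x hx => hsT x hx, fun g hg => Submodule.mem_colon.1 hs.1 g hg,
    fun g hg => Submodule.mem_colon.1 hs.2 g hg⟩

open Submodule in
/-- Simultaneous choice of local equations at finitely many points `x ∈ T` of affine space: the
`f i ∈ J` have gradients at `x` that span those of `J`, and `t ∈ J'` has a gradient independent of
these. If `V(J')` does not pass through `x`, then `t` does not vanish at `x`. -/
theorem exists_local_equations {A : Type*} [CommRing A] {c : ℕ}
    (T : Finset (PrimeSpectrum (MvPolynomial (Fin (c + 1)) A)))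
    (hT : IsAntichain (· ≤ ·) (T : Set (PrimeSpectrum (MvPolynomial (Fin (c + 1)) A))))
    (J J' : Ideal (MvPolynomial (Fin (c + 1)) A)) (hJT : ∀ x ∈ T, J ≤ x.asIdeal)
    (hrank : ∀ x ∈ T,
      Module.finrank x.asIdeal.ResidueField
        (span x.asIdeal.ResidueField (gradAt x '' J)) = c)
    (hJ' : ∀ x ∈ T, J' ≤ x.asIdeal → span x.asIdeal.ResidueField (gradAt x '' J') = ⊤) :
    ∃ (f : Fin c → MvPolynomial (Fin (c + 1)) A) (t : MvPolynomial (Fin (c + 1)) A),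
      (∀ i, f i ∈ J) ∧ t ∈ J' ∧ ∀ x ∈ T,
        span x.asIdeal.ResidueField (Set.range fun i => gradAt x (f i)) =
          span x.asIdeal.ResidueField (gradAt x '' J) ∧
        LinearIndependent x.asIdeal.ResidueField
          (fun i => gradAt x ((Fin.cons t f : Fin (c + 1) → MvPolynomial (Fin (c + 1)) A) i)) ∧
        (J' ≤ x.asIdeal ∨ t ∉ x.asIdeal) := by
  classical
  -- the weights `e x` combine local choices into `∑ e x * f x` and `∑ (e x)² * s x`, whose
  -- gradients at `x` see only the summand at `x`; squares are needed since `s y` need not vanish there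
  choose! e he heT using fun x (hx : x ∈ T) => exists_notMem_forall_mem T hT hx
  have h1 : ∀ x ∈ T, ∃ f : Fin c → MvPolynomial (Fin (c + 1)) A, (∀ i, f i ∈ J) ∧
      LinearIndependent x.asIdeal.ResidueField fun i => gradAt x (f i) := by
    intro x hx
    obtain ⟨v, hv, -, hli⟩ := exists_fun_fin_finrank_span_eq x.asIdeal.ResidueField
      (gradAt x '' (J : Set (MvPolynomial (Fin (c + 1)) A)))
    choose g hg hgv using hv
    refine ⟨fun i => g (Fin.cast (hrank x hx).symm i), fun i => hg _, ?_⟩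
    simp_rw [hgv]
    exact hli.comp _ (Fin.cast_injective _)
  choose! f hfJ hf using h1
  have h2 : ∀ x ∈ T, ∃ s ∈ J', gradAt x (e x ^ 2 * s) ∉ span x.asIdeal.ResidueField (gradAt x '' J) ∧
      (J' ≤ x.asIdeal ∨ s ∉ x.asIdeal) := by
    intro x hx
    refine exists_mem_gradAt_mul_notMem x J' _ (fun htop => ?_) (hJ' x hx)
      (fun h => he x hx (x.2.mem_of_pow_mem _ h))
    have := hrank x hx
    rw [htop, finrank_top] at this
    simp at this
  choose! s hsJ' hsV hsx using h2
  have hft : ∀ x ∈ T, ∀ i, gradAt x (∑ y ∈ T, e y * f y i) =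
      algebraMap _ x.asIdeal.ResidueField (e x) • gradAt x (f x i) := by
    intro x hx i
    rw [map_sum, Finset.sum_eq_single_of_mem x hx,
      gradAt_mul_of_mem _ _ (hJT x hx (hfJ x hx i))]
    intro y hy hyx
    rw [gradAt_mul_of_mem _ _ (hJT x hx (hfJ y hy i)),
      Ideal.algebraMap_residueField_eq_zero.2 (heT y hy x hx hyx.symm), zero_smul]
  have hst : ∀ x ∈ T, gradAt x (∑ y ∈ T, e y ^ 2 * s y) = gradAt x (e x ^ 2 * s x) := by
    intro x hx
    rw [map_sum, Finset.sum_eq_single_of_mem x hx]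
    intro y hy hyx
    have h0 := Ideal.algebraMap_residueField_eq_zero.2 (heT y hy x hx hyx.symm)
    simp [pow_two, gradAt_mul, h0]
  refine ⟨fun i => ∑ y ∈ T, e y * f y i, ∑ y ∈ T, e y ^ 2 * s y,
    fun i => J.sum_mem fun y hy => J.mul_mem_left _ (hfJ y hy i),
    J'.sum_mem fun y hy => J'.mul_mem_left _ (hsJ' y hy), fun x hx => ?_⟩
  have hli : LinearIndependent x.asIdeal.ResidueField
      fun i => gradAt x (∑ y ∈ T, e y * f y i) := by
    simp_rw [hft x hx]
    have hu : IsUnit (algebraMap _ x.asIdeal.ResidueField (e x)) :=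
      isUnit_iff_ne_zero.2 (by rw [Ne, Ideal.algebraMap_residueField_eq_zero]; exact he x hx)
    exact (hf x hx).units_smul fun _ => hu.unit
  have hspan : span x.asIdeal.ResidueField
      (Set.range fun i => gradAt x (∑ y ∈ T, e y * f y i)) =
      span x.asIdeal.ResidueField (gradAt x '' J) := by
    refine eq_of_le_of_finrank_eq (span_mono ?_) ?_
    · rintro _ ⟨i, rfl⟩
      exact ⟨_, J.sum_mem fun y hy => J.mul_mem_left _ (hfJ y hy i), rfl⟩
    · rw [finrank_span_eq_card hli, hrank x hx, Fintype.card_fin]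
  refine ⟨hspan, ?_, (hsx x hx).imp id fun h ht => ?_⟩
  · have : (fun i => gradAt x ((Fin.cons (∑ y ∈ T, e y ^ 2 * s y)
        (fun i => ∑ y ∈ T, e y * f y i) : Fin (c + 1) → MvPolynomial (Fin (c + 1)) A) i)) =
        Fin.cons (gradAt x (∑ y ∈ T, e y ^ 2 * s y))
          (fun i => gradAt x (∑ y ∈ T, e y * f y i)) := by
      ext i : 1
      refine Fin.cases ?_ (fun i => ?_) i <;> simp
    rw [this, linearIndependent_finCons]
    exact ⟨hli, by rw [hspan, hst x hx]; exact hsV x hx⟩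
  · rw [← Finset.add_sum_erase T _ hx, x.asIdeal.add_mem_iff_left] at ht
    · exact (x.2.mem_or_mem ht).elim (fun h' => he x hx (x.2.mem_of_pow_mem _ h')) h
    · refine x.asIdeal.sum_mem fun y hy => x.asIdeal.mul_mem_right _ ?_
      exact x.asIdeal.pow_mem_of_mem (heT y (Finset.mem_of_mem_erase hy) x hx
        (Finset.ne_of_mem_erase hy).symm) 2 two_pos

/-! ### The conormal sequence at a point -/

/-- If `L` is a formally smooth quotient of the formally smooth algebra `Q`, then the conormal
module of `L` is a direct summand of the differentials of `Q`, so that an equation of `L` whose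
differential lies in `m Ω` lies itself in `m` times the ideal of `L`. -/
theorem mem_mul_ker_of_D_mem {R Q L : Type*} [CommRing R] [CommRing Q] [CommRing L] [Algebra R Q]
    [Algebra R L] [Algebra Q L] [IsScalarTower R Q L] [Algebra.FormallySmooth R Q]
    [Algebra.FormallySmooth R L] (hQL : Function.Surjective (algebraMap Q L)) (m : Ideal Q)
    (hm : RingHom.ker (algebraMap Q L) ≤ m) {u : Q} (hu : u ∈ RingHom.ker (algebraMap Q L))
    (hDu : KaehlerDifferential.D R Q u ∈ m • (⊤ : Submodule Q Ω[Q⁄R])) :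
    u ∈ m * RingHom.ker (algebraMap Q L) := by
  obtain ⟨l, hl⟩ := (Algebra.FormallySmooth.iff_split_injection (R := R) hQL).1 inferInstance
  have h1 : (RingHom.ker (algebraMap Q L)).toCotangent ⟨u, hu⟩ =
      l (1 ⊗ₜ KaehlerDifferential.D R Q u) := by
    rw [← KaehlerDifferential.kerCotangentToTensor_toCotangent R Q L ⟨u, hu⟩]
    exact (LinearMap.congr_fun hl _).symm
  have h2 : (RingHom.ker (algebraMap Q L)).toCotangent ⟨u, hu⟩ ∈
      m • (⊤ : Submodule Q (RingHom.ker (algebraMap Q L)).Cotangent) := by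
    let φ : Ω[Q⁄R] →ₗ[Q] (RingHom.ker (algebraMap Q L)).Cotangent :=
      l ∘ₗ (TensorProduct.mk Q L Ω[Q⁄R] 1)
    have h3 : φ (KaehlerDifferential.D R Q u) ∈ (m • (⊤ : Submodule Q Ω[Q⁄R])).map φ :=
      ⟨_, hDu, rfl⟩
    rw [Submodule.map_smul''] at h3
    rw [h1]
    exact Submodule.smul_mono le_rfl le_top h3
  have h4 : m • (⊤ : Submodule Q (RingHom.ker (algebraMap Q L)).Cotangent) =
      (m • (⊤ : Submodule Q (RingHom.ker (algebraMap Q L)))).map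
        (RingHom.ker (algebraMap Q L)).toCotangent := by
    rw [Submodule.map_smul'', Submodule.map_top,
      LinearMap.range_eq_top.2 (Ideal.toCotangent_surjective _)]
  rw [h4] at h2
  obtain ⟨v, hv, hvu⟩ := h2
  have hv' : (v : Q) ∈ m * RingHom.ker (algebraMap Q L) := by
    have : (v : Q) ∈ (m • (⊤ : Submodule Q (RingHom.ker (algebraMap Q L)))).map
      (RingHom.ker (algebraMap Q L)).subtype := ⟨v, hv, rfl⟩
    rwa [Submodule.map_smul'', Submodule.map_top, Submodule.range_subtype] at this
  have hd : u - v ∈ RingHom.ker (algebraMap Q L) ^ 2 := by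
    have := (Ideal.toCotangent_eq_zero _ (⟨u, hu⟩ - v)).1 (by rw [map_sub, hvu, sub_self])
    simpa using this
  rw [← sub_add_cancel u (v : Q)]
  refine add_mem ?_ hv'
  rw [pow_two] at hd
  exact Ideal.mul_mono_left hm hd

theorem D_algebraMap_eq_sum {A ι Q : Type*} [CommRing A] [CommRing Q] [Fintype ι]
    [Algebra (MvPolynomial ι A) Q] [Algebra A Q] [IsScalarTower A (MvPolynomial ι A) Q]
    (g : MvPolynomial ι A) :
    KaehlerDifferential.D A Q (algebraMap _ Q g) = ∑ j,
      algebraMap (MvPolynomial ι A) Q (MvPolynomial.pderiv j g) •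
        KaehlerDifferential.D A Q (algebraMap (MvPolynomial ι A) Q (MvPolynomial.X j)) := by
  have h := (KaehlerDifferential.mvPolynomialBasis A ι).sum_repr
    (KaehlerDifferential.D A (MvPolynomial ι A) g)
  have h' := congrArg (KaehlerDifferential.map A A (MvPolynomial ι A) Q) h
  simpa [KaehlerDifferential.mvPolynomialBasis_repr_apply, algebraMap_smul] using h'.symm

theorem D_sub_sum_mem {A ι κ Q : Type*} [CommRing A] [CommRing Q] [Fintype ι] [Fintype κ]
    [Algebra (MvPolynomial ι A) Q] [Algebra A Q] [IsScalarTower A (MvPolynomial ι A) Q]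
    (m : Ideal Q) (g : MvPolynomial ι A) (f : κ → MvPolynomial ι A) (d : κ → Q)
    (hf : ∀ i, algebraMap _ Q (f i) ∈ m)
    (hd : ∀ j, algebraMap (MvPolynomial ι A) Q (MvPolynomial.pderiv j g) -
      ∑ i, d i * algebraMap (MvPolynomial ι A) Q (MvPolynomial.pderiv j (f i)) ∈ m) :
    KaehlerDifferential.D A Q (algebraMap _ Q g - ∑ i, d i * algebraMap _ Q (f i)) ∈
      m • (⊤ : Submodule Q Ω[Q⁄A]) := by
  have h1 : KaehlerDifferential.D A Q (algebraMap _ Q g - ∑ i, d i * algebraMap _ Q (f i)) =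
      (∑ j, (algebraMap (MvPolynomial ι A) Q (MvPolynomial.pderiv j g) -
        ∑ i, d i * algebraMap (MvPolynomial ι A) Q (MvPolynomial.pderiv j (f i))) •
          KaehlerDifferential.D A Q (algebraMap (MvPolynomial ι A) Q (MvPolynomial.X j))) -
      ∑ i, algebraMap _ Q (f i) • KaehlerDifferential.D A Q (d i) := by
    simp only [map_sub, map_sum, Derivation.leibniz]
    rw [D_algebraMap_eq_sum g]
    simp only [D_algebraMap_eq_sum (f _), sub_smul, Finset.sum_sub_distrib,
      Finset.sum_add_distrib, Finset.smul_sum, smul_smul, Finset.sum_smul]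
    rw [Finset.sum_comm (γ := κ)]
    abel
  rw [h1]
  exact sub_mem (sum_mem fun j _ => Submodule.smul_mem_smul (hd j) trivial)
    (sum_mem fun i _ => Submodule.smul_mem_smul (hf i) trivial)

/-- Local equations of a smooth closed subscheme: if the gradients at `x` of the equations `f i`
span those of all equations, then the `f i` generate the ideal near `x`. -/
theorem exists_mul_mem_span_of_gradAt {A ι B κ : Type*} [CommRing A] [CommRing B] [Algebra A B]
    [Fintype ι] [Finite κ] (π : MvPolynomial ι A →ₐ[A] B) (hπ : Function.Surjective π)
    (hfg : (RingHom.ker π).FG) (q : PrimeSpectrum B)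
    [Algebra.FormallySmooth A (Localization.AtPrime q.asIdeal)]
    (f : κ → MvPolynomial ι A) (hf : ∀ i, f i ∈ RingHom.ker π)
    (hspan : ∀ g ∈ RingHom.ker π, gradAt (q.comap π.toRingHom) g ∈
      Submodule.span (q.comap π.toRingHom).asIdeal.ResidueField
        (Set.range fun i => gradAt (q.comap π.toRingHom) (f i)))
    (g : MvPolynomial ι A) (hg : g ∈ RingHom.ker π) :
    ∃ s ∉ (q.comap π.toRingHom).asIdeal, s * g ∈ Ideal.span (Set.range f) := by
  classical
  have := Fintype.ofFinite κ
  set x := q.comap π.toRingHom with hx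
  let Q := Localization.AtPrime x.asIdeal
  let L := Localization.AtPrime q.asIdeal
  have hmap : x.asIdeal.primeCompl.map π.toRingHom = q.asIdeal.primeCompl := by
    ext b
    obtain ⟨a, rfl⟩ := hπ b
    constructor
    · rintro ⟨a', ha', h'⟩
      rw [← h']
      exact ha'
    · intro h
      exact ⟨a, h, rfl⟩
  have hloc : IsLocalization (x.asIdeal.primeCompl.map π.toRingHom) L := by
    rw [hmap]; infer_instance
  let ψ : Q →+* L := IsLocalization.map L π.toRingHom
    (hmap ▸ Submonoid.le_comap_map _ : x.asIdeal.primeCompl ≤ q.asIdeal.primeCompl.comap π.toRingHom)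
  have hψ : Function.Surjective ψ :=
    IsLocalization.map_surjective_of_surjective x.asIdeal.primeCompl Q L hπ
  have hker : RingHom.ker ψ = (RingHom.ker π).map (algebraMap _ Q) :=
    IsLocalization.ker_map L π.toRingHom hmap
  let _ : Algebra Q L := ψ.toAlgebra
  have : IsScalarTower A Q L := by
    refine .of_algebraMap_eq fun a => ?_
    rw [IsScalarTower.algebraMap_apply A (MvPolynomial ι A) Q, IsScalarTower.algebraMap_apply A B L]
    change _ = ψ _
    rw [IsLocalization.map_eq]
    congr 1
    exact (π.commutes a).symm
  have : Algebra.FormallySmooth A Q := inferInstance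
  let m := IsLocalRing.maximalIdeal Q
  have hres (a : MvPolynomial ι A) : algebraMap _ x.asIdeal.ResidueField a =
      IsLocalRing.residue Q (algebraMap _ Q a) := rfl
  have hNm : RingHom.ker (algebraMap Q L) ≤ m := by
    refine IsLocalRing.le_maximalIdeal ?_
    exact RingHom.ker_ne_top _
  -- modulo the `f i`, an equation `g` has differential zero at `x`, so it lies in `m` times the
  -- ideal of `L`; by Nakayama's lemma the `f i` generate this ideal
  have key : RingHom.ker (algebraMap Q L) ≤
      (Ideal.span (Set.range f)).map (algebraMap _ Q) ⊔ m • RingHom.ker (algebraMap Q L) := by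
    change RingHom.ker ψ ≤ _
    rw [hker, Ideal.map_le_iff_le_comap]
    intro g hg
    obtain ⟨c, hc⟩ := (Submodule.mem_span_range_iff_exists_fun _).1 (hspan g hg)
    choose d hd using fun i => IsLocalRing.residue_surjective (c i)
    have hmem (a) (ha : a ∈ RingHom.ker π) : algebraMap _ Q a ∈ RingHom.ker (algebraMap Q L) := by
      change _ ∈ RingHom.ker ψ
      rw [hker]
      exact Ideal.mem_map_of_mem _ ha
    have hu : algebraMap _ Q g - ∑ i, d i * algebraMap _ Q (f i) ∈
        RingHom.ker (algebraMap Q L) :=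
      sub_mem (hmem g hg) (sum_mem fun i _ => Ideal.mul_mem_left _ _ (hmem _ (hf i)))
    have hDu : KaehlerDifferential.D A Q (algebraMap _ Q g - ∑ i, d i * algebraMap _ Q (f i)) ∈
        m • (⊤ : Submodule Q Ω[Q⁄A]) := by
      refine D_sub_sum_mem m g f d (fun i => hNm (hmem _ (hf i))) fun j => ?_
      rw [← IsLocalRing.residue_eq_zero_iff, map_sub, map_sum, ← hres]
      have := congrFun hc j
      simp only [Finset.sum_apply, Pi.smul_apply, gradAt_apply, smul_eq_mul] at this
      rw [← this, sub_eq_zero]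
      refine Finset.sum_congr rfl fun i _ => ?_
      rw [map_mul, hd, hres]
    have := mem_mul_ker_of_D_mem (R := A) hψ m hNm hu hDu
    rw [Ideal.mem_comap, ← add_sub_cancel (∑ i, d i * algebraMap _ Q (f i)) (algebraMap _ Q g)]
    refine add_mem (Ideal.mem_sup_left (sum_mem fun i _ => Ideal.mul_mem_left _ _ ?_))
      (Ideal.mem_sup_right this)
    exact Ideal.mem_map_of_mem _ (Ideal.subset_span ⟨i, rfl⟩)
  have hle := Submodule.le_of_le_smul_of_le_jacobson_bot
    (show (RingHom.ker (algebraMap Q L)).FG by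
      change (RingHom.ker ψ).FG
      rw [hker]
      exact hfg.map _) (IsLocalRing.maximalIdeal_le_jacobson _) key
  have hgQ : algebraMap _ Q g ∈ (Ideal.span (Set.range f)).map (algebraMap _ Q) := by
    refine hle ?_
    change _ ∈ RingHom.ker ψ
    rw [hker]
    exact Ideal.mem_map_of_mem _ hg
  obtain ⟨s, hs, hsg⟩ :=
    (IsLocalization.algebraMap_mem_map_algebraMap_iff x.asIdeal.primeCompl Q _ _).1 hgQ
  exact ⟨s, hs, hsg⟩

theorem ker_baseChange_le_span {B K M N : Type*} [CommRing B] [CommRing K] [Algebra B K]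
    [AddCommGroup M] [AddCommGroup N] [Module B M] [Module B N] (φ : M →ₗ[B] N)
    (hφ : Function.Surjective φ) :
    (φ.baseChange K).ker ≤ Submodule.span K ((fun y => (1 : K) ⊗ₜ[B] y) '' (φ.ker : Set M)) := by
  have hex : Function.Exact (φ.ker.subtype.lTensor K) (φ.lTensor K) :=
    lTensor_exact (M := φ.ker) K φ.exact_subtype_ker_map hφ
  intro z hz
  obtain ⟨y, rfl⟩ := (hex z).1 hz
  clear hz
  induction y with
  | zero => simp
  | add y₁ y₂ h₁ h₂ =>
    rw [map_add]
    exact add_mem h₁ h₂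
  | tmul k y =>
    have : (k ⊗ₜ[B] y.1 : K ⊗[B] M) = k • ((1 : K) ⊗ₜ[B] y.1) := by
      rw [TensorProduct.smul_tmul', smul_eq_mul, mul_one]
    rw [LinearMap.lTensor_tmul, Submodule.subtype_apply, this]
    exact Submodule.smul_mem _ _ (Submodule.subset_span ⟨y.1, y.2, rfl⟩)

/-- The conormal sequence at a point with values in the field `K`: the gradients of the equations
of `B` in affine space have corank the rank of the differentials of `B`. -/
theorem finrank_span_pderiv_add {A ι B K : Type*} [CommRing A] [CommRing B] [Field K]
    [Algebra A B] [Fintype ι] [Algebra (MvPolynomial ι A) B] [IsScalarTower A (MvPolynomial ι A) B]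
    (hB : Function.Surjective (algebraMap (MvPolynomial ι A) B)) [Algebra B K]
    [Algebra (MvPolynomial ι A) K] [IsScalarTower (MvPolynomial ι A) B K] :
    Module.finrank K (Submodule.span K
      ((fun g j => algebraMap (MvPolynomial ι A) K (MvPolynomial.pderiv j g)) ''
        (RingHom.ker (algebraMap (MvPolynomial ι A) B) : Set (MvPolynomial ι A)))) +
      Module.finrank K (K ⊗[B] Ω[B⁄A]) = Fintype.card ι := by
  classical
  let P := MvPolynomial ι A
  let b : Module.Basis ι K (K ⊗[B] (B ⊗[P] Ω[P⁄A])) :=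
    ((KaehlerDifferential.mvPolynomialBasis A ι).baseChange B).baseChange K
  let φ : B ⊗[P] Ω[P⁄A] →ₗ[B] Ω[B⁄A] := KaehlerDifferential.mapBaseChange A P B
  have hφ : Function.Surjective φ := KaehlerDifferential.mapBaseChange_surjective A P B hB
  let ψ := φ.baseChange K
  have hψ : Function.Surjective ψ := LinearMap.lTensor_surjective K hφ
  have hrange : ψ.ker = Submodule.span K
      ((fun g : P => (1 : K) ⊗ₜ[B] ((1 : B) ⊗ₜ[P] KaehlerDifferential.D A P g)) ''
        (RingHom.ker (algebraMap P B) : Set P)) := by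
    apply le_antisymm
    · refine (ker_baseChange_le_span φ hφ).trans (Submodule.span_mono ?_)
      rintro _ ⟨y, hy, rfl⟩
      obtain ⟨w, rfl⟩ :=
        (KaehlerDifferential.exact_kerCotangentToTensor_mapBaseChange A P B hB y).1 hy
      obtain ⟨g, rfl⟩ := Ideal.toCotangent_surjective _ w
      rw [KaehlerDifferential.kerCotangentToTensor_toCotangent]
      exact ⟨g.1, g.2, rfl⟩
    · rw [Submodule.span_le]
      rintro _ ⟨g, hg, rfl⟩
      have : φ ((1 : B) ⊗ₜ[P] KaehlerDifferential.D A P g) = 0 := by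
        rw [← KaehlerDifferential.kerCotangentToTensor_toCotangent A P B ⟨g, hg⟩]
        exact (KaehlerDifferential.exact_kerCotangentToTensor_mapBaseChange A P B
          hB).apply_apply_eq_zero _
      change ψ _ = 0
      simp [ψ, this]
  have himg : (ψ.ker).map b.equivFun.toLinearMap = Submodule.span K
      ((fun g j => algebraMap P K (MvPolynomial.pderiv j g)) ''
        (RingHom.ker (algebraMap P B) : Set P)) := by
    rw [hrange, Submodule.map_span, Set.image_image]
    congr 1
    refine Set.image_congr fun g _ => ?_
    ext j
    have h1 : ((KaehlerDifferential.mvPolynomialBasis A ι).baseChange B).repr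
        ((1 : B) ⊗ₜ[P] KaehlerDifferential.D A P g) j =
        algebraMap P B (MvPolynomial.pderiv j g) := by
      rw [Module.Basis.baseChange_repr_tmul, KaehlerDifferential.mvPolynomialBasis_repr_apply,
        Algebra.smul_def, mul_one]
    simp only [b, LinearEquiv.coe_coe, Module.Basis.equivFun_apply]
    rw [Module.Basis.baseChange_repr_tmul, h1, Algebra.smul_def, mul_one,
      ← IsScalarTower.algebraMap_apply]
  rw [← himg, LinearEquiv.finrank_map_eq]
  have : FiniteDimensional K (K ⊗[B] (B ⊗[P] Ω[P⁄A])) := .of_basis b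
  have := LinearMap.finrank_range_add_finrank_ker ψ
  rw [LinearMap.range_eq_top.2 hψ, finrank_top, Module.finrank_eq_card_basis b] at this
  rw [add_comm]
  exact this

/-! ### Equations of a smooth curve with a section -/

/-- At a point where `b` does not vanish, the differentials of `B` have the rank of those of the
localization at `b`. -/
theorem finrank_tensor_kaehlerDifferential {A B K : Type*} [CommRing A] [CommRing B] [Field K]
    [Algebra A B] [Algebra B K] (b : B) (hb : algebraMap B K b ≠ 0) (n : ℕ)
    [Algebra.IsStandardSmoothOfRelativeDimension n A (Localization.Away b)] :
    Module.finrank K (K ⊗[B] Ω[B⁄A]) = n := by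
  let L := Localization.Away b
  let ψ : L →+* K := IsLocalization.Away.lift b (isUnit_iff_ne_zero.2 hb)
  let _ : Algebra L K := ψ.toAlgebra
  have : IsScalarTower B L K := .of_algebraMap_eq fun x =>
    (IsLocalization.Away.lift_eq b (isUnit_iff_ne_zero.2 hb) x).symm
  have : Nontrivial L := ψ.domain_nontrivial
  have : Algebra.FormallyEtale B L := .of_isLocalization (.powers b)
  have : Algebra.IsStandardSmooth A L :=
    Algebra.IsStandardSmoothOfRelativeDimension.isStandardSmooth n
  have h1 : Module.finrank L Ω[L⁄A] = n := Module.finrank_eq_of_rank_eq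
    (Algebra.IsStandardSmoothOfRelativeDimension.rank_kaehlerDifferential n)
  let e₁ : K ⊗[L] (L ⊗[B] Ω[B⁄A]) ≃ₗ[K] K ⊗[B] Ω[B⁄A] :=
    TensorProduct.AlgebraTensorModule.cancelBaseChange B L K K Ω[B⁄A]
  let e₂ : K ⊗[L] (L ⊗[B] Ω[B⁄A]) ≃ₗ[K] K ⊗[L] Ω[L⁄A] :=
    (KaehlerDifferential.tensorKaehlerEquivOfFormallyEtale A B L).baseChange (A := K)
  rw [← e₁.finrank_eq, e₂.finrank_eq, Module.finrank_baseChange, h1]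

theorem formallySmooth_localization_atPrime {A B : Type*} [CommRing A] [CommRing B]
    [Algebra A B] (b : B) [Algebra.FormallySmooth A (Localization.Away b)] (q : Ideal B)
    [q.IsPrime] (hb : b ∉ q) : Algebra.FormallySmooth A (Localization.AtPrime q) := by
  let L := Localization.Away b
  have hle : Submonoid.powers b ≤ q.primeCompl := by
    rw [Submonoid.powers_le]; exact hb
  let _ : Algebra L (Localization.AtPrime q) :=
    IsLocalization.localizationAlgebraOfSubmonoidLe L (Localization.AtPrime q) _ _ hle
  have : IsScalarTower B L (Localization.AtPrime q) :=
    IsLocalization.localization_isScalarTower_of_submonoid_le _ _ _ _ hle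
  have : IsScalarTower A L (Localization.AtPrime q) := by
    refine .of_algebraMap_eq fun a => ?_
    rw [IsScalarTower.algebraMap_apply A B L, ← IsScalarTower.algebraMap_apply B L,
      ← IsScalarTower.algebraMap_apply]
  have := IsLocalization.isLocalization_of_submonoid_le L (Localization.AtPrime q) _ _ hle
  have : Algebra.FormallySmooth L (Localization.AtPrime q) :=
    .of_isLocalization (q.primeCompl.map (algebraMap B L))
  exact .comp A L _

/-- At a point of relative dimension one of a closed subscheme of affine space of dimension `c + 1`,
the gradients of its equations span a space of dimension `c`. -/
theorem finrank_span_gradAt {A B : Type*} [CommRing A] [CommRing B] [Algebra A B] {c : ℕ}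
    (π : MvPolynomial (Fin (c + 1)) A →ₐ[A] B) (hπ : Function.Surjective π) (q : PrimeSpectrum B)
    (b : B) (hb : b ∉ q.asIdeal)
    [Algebra.IsStandardSmoothOfRelativeDimension 1 A (Localization.Away b)] :
    Module.finrank (q.comap π.toRingHom).asIdeal.ResidueField
      (Submodule.span (q.comap π.toRingHom).asIdeal.ResidueField
        (gradAt (q.comap π.toRingHom) ''
          (RingHom.ker π : Set (MvPolynomial (Fin (c + 1)) A)))) = c := by
  set x := q.comap π.toRingHom with hx
  let K := x.asIdeal.ResidueField
  have hker : RingHom.ker π.toRingHom ≤ RingHom.ker (algebraMap _ K) := by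
    intro g hg
    rw [RingHom.mem_ker] at hg ⊢
    rw [Ideal.algebraMap_residueField_eq_zero, hx, PrimeSpectrum.comap_asIdeal, Ideal.mem_comap, hg]
    exact zero_mem _
  let ψ : B →+* K := RingHom.liftOfSurjective π.toRingHom hπ ⟨algebraMap _ K, hker⟩
  have hψ : ψ.comp π.toRingHom = algebraMap _ K :=
    RingHom.liftOfSurjective_comp π.toRingHom hπ ⟨algebraMap _ K, hker⟩
  let _ : Algebra B K := ψ.toAlgebra
  let _ : Algebra (MvPolynomial (Fin (c + 1)) A) B := π.toRingHom.toAlgebra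
  have : IsScalarTower A (MvPolynomial (Fin (c + 1)) A) B :=
    .of_algebraMap_eq' π.comp_algebraMap.symm
  have : IsScalarTower (MvPolynomial (Fin (c + 1)) A) B K := .of_algebraMap_eq' hψ.symm
  have h1 : algebraMap B K b ≠ 0 := by
    obtain ⟨g, rfl⟩ := hπ b
    intro h0
    have h2 : algebraMap _ K g = 0 := by
      rw [← hψ]
      exact h0
    rw [Ideal.algebraMap_residueField_eq_zero] at h2
    exact hb h2
  have h2 := finrank_span_pderiv_add (A := A) (ι := Fin (c + 1)) (B := B) (K := K) hπ
  rw [finrank_tensor_kaehlerDifferential (A := A) b h1 1, Fintype.card_fin] at h2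
  exact Nat.succ.inj h2

/-- Let `Spec B` be a closed subscheme of affine space over `A₀`, smooth of relative dimension one at
the points of `T`, and let `σ` be a section of `Spec B → Spec A₀`. Near `T`, the curve `Spec B` is
cut out by `c` equations, and one more cuts out the section. These equations lift to polynomials
`F 1, …, F c` and `F 0` over the ring `A`, of which `A₀` is a quotient, such that the Jacobian
determinant of `F` is invertible on an open set `h ≠ 0` that contains `T`. -/
theorem exists_lift_equations {A A₀ B : Type*} [CommRing A] [CommRing A₀] [CommRing B]
    [IsNoetherianRing A₀] [Algebra A₀ B] {c : ℕ} (ρ : A →+* A₀) (hρ : Function.Surjective ρ)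
    (π : MvPolynomial (Fin (c + 1)) A₀ →ₐ[A₀] B) (hπ : Function.Surjective π) (σ : B →ₐ[A₀] A₀)
    (T : Finset (PrimeSpectrum B)) (hT : IsAntichain (· ≤ ·) (T : Set (PrimeSpectrum B)))
    (hsm : ∀ q ∈ T, ∃ b ∉ q.asIdeal,
      Algebra.IsStandardSmoothOfRelativeDimension 1 A₀ (Localization.Away b)) :
    ∃ (F : Fin (c + 1) → MvPolynomial (Fin (c + 1)) A) (h : MvPolynomial (Fin (c + 1)) A),
      (∀ i : Fin c, π (MvPolynomial.map ρ (F i.succ)) = 0) ∧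
      σ (π (MvPolynomial.map ρ (F 0))) = 0 ∧
      (Matrix.of fun i j => MvPolynomial.pderiv j (F i)).det ∣ h ∧
      (∀ q ∈ T, π (MvPolynomial.map ρ h) ∉ q.asIdeal) ∧
      (∀ g, π (MvPolynomial.map ρ g) = 0 → h * g ∈
        Ideal.span (Set.range fun i : Fin c => F i.succ) ⊔ (RingHom.ker ρ).map MvPolynomial.C) ∧
      (∀ g, σ (π (MvPolynomial.map ρ g)) = 0 → h * g ∈
        Ideal.span (Set.range F) ⊔ (RingHom.ker ρ).map MvPolynomial.C) := by
  classical
  let P := MvPolynomial (Fin (c + 1)) A₀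
  let J : Ideal P := RingHom.ker π
  let J' : Ideal P := RingHom.ker (σ.comp π)
  have hσ : Function.Surjective (σ.comp π) := fun a =>
    ⟨MvPolynomial.C a, (σ.comp π).commutes a⟩
  let TP : Finset (PrimeSpectrum P) := T.image (PrimeSpectrum.comap π.toRingHom)
  have hTP : IsAntichain (· ≤ ·) (TP : Set (PrimeSpectrum P)) := by
    intro x hx y hy hxy hle
    obtain ⟨p, hp, rfl⟩ := Finset.mem_image.1 hx
    obtain ⟨q, hq, rfl⟩ := Finset.mem_image.1 hy
    refine hT hp hq (fun h => hxy (by rw [h])) fun b hb => ?_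
    obtain ⟨g, rfl⟩ := hπ b
    exact hle hb
  have hJT : ∀ x ∈ TP, J ≤ x.asIdeal := by
    intro x hx g hg
    obtain ⟨p, hp, rfl⟩ := Finset.mem_image.1 hx
    change π g ∈ p.asIdeal
    rw [show π g = 0 from hg]
    exact zero_mem _
  have hrank : ∀ x ∈ TP, Module.finrank x.asIdeal.ResidueField
        (Submodule.span x.asIdeal.ResidueField (gradAt x '' J)) = c := by
    intro x hx
    obtain ⟨p, hp, rfl⟩ := Finset.mem_image.1 hx
    obtain ⟨b, hb, hsb⟩ := hsm p hp
    exact finrank_span_gradAt π hπ p b hb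
  have hJ' : ∀ x ∈ TP, J' ≤ x.asIdeal →
      Submodule.span x.asIdeal.ResidueField (gradAt x '' J') = ⊤ := by
    intro x _ _
    rw [eq_top_iff, ← (Pi.basisFun x.asIdeal.ResidueField (Fin (c + 1))).span_eq]
    refine Submodule.span_mono ?_
    rintro _ ⟨j, rfl⟩
    -- the section is the graph of a map, with equations `X j = a j`
    refine ⟨MvPolynomial.X j - MvPolynomial.C (σ (π (MvPolynomial.X j))), ?_, ?_⟩
    · change σ.comp π _ = 0
      rw [map_sub, sub_eq_zero]
      exact ((σ.comp π).commutes _).symm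
    · rw [map_sub, gradAt_X, gradAt_C, sub_zero, Pi.basisFun_apply]
  obtain ⟨f, t, hf, ht, hft⟩ := exists_local_equations TP hTP J J' hJT hrank hJ'
  let F₀ : Fin (c + 1) → P := Fin.cons t f
  have hgen : ∀ x ∈ TP, ∀ g ∈ J, ∃ s ∉ x.asIdeal, s * g ∈ Ideal.span (Set.range f) := by
    intro x hx g hg
    obtain ⟨p, hp, rfl⟩ := Finset.mem_image.1 hx
    obtain ⟨b, hb, hsb⟩ := hsm p hp
    have : Algebra.IsStandardSmooth A₀ (Localization.Away b) :=
      Algebra.IsStandardSmoothOfRelativeDimension.isStandardSmooth 1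
    have := formallySmooth_localization_atPrime (A := A₀) b p.asIdeal hb
    refine exists_mul_mem_span_of_gradAt π hπ (IsNoetherian.noetherian _) p f hf
      (fun g hg => ?_) g hg
    rw [(hft _ hx).1]
    exact Submodule.subset_span ⟨g, hg, rfl⟩
  -- where the section passes, it is smooth of relative dimension zero over `A₀`; elsewhere `t` is
  -- invertible
  have hgen' : ∀ x ∈ TP, ∀ g ∈ J', ∃ s ∉ x.asIdeal, s * g ∈ Ideal.span (Set.range F₀) := by
    intro x hx g hg
    rcases (hft x hx).2.2 with h | h
    · obtain ⟨q, rfl⟩ : ∃ q : PrimeSpectrum A₀, q.comap (σ.comp π).toRingHom = x := by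
        have := range_comap_of_surjective A₀ (σ.comp π).toRingHom hσ
        exact this.symm.le (show x ∈ PrimeSpectrum.zeroLocus _ from h)
      refine exists_mul_mem_span_of_gradAt (σ.comp π) hσ (IsNoetherian.noetherian _) q F₀
        (fun i => ?_) (fun g _ => ?_) g hg
      · refine Fin.cases ht (fun i => ?_) i
        change σ (π (f i)) = 0
        rw [show π (f i) = 0 from hf i, map_zero]
      · rw [(hft _ hx).2.1.span_eq_top_of_card_eq_finrank
          (Module.finrank_pi _).symm]
        trivial
    · exact ⟨t, h, Ideal.mul_mem_right _ _ (Ideal.subset_span ⟨0, rfl⟩)⟩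
  obtain ⟨s, hs, hsJ, hsJ'⟩ := exists_forall_notMem_mul_mem TP J J' _ _
    (IsNoetherian.noetherian _) (IsNoetherian.noetherian _) hgen hgen'
  have hdet : ∀ x ∈ TP, (Matrix.of fun i j => MvPolynomial.pderiv j (F₀ i)).det ∉ x.asIdeal := by
    intro x hx hmem
    have h1 : LinearIndependent x.asIdeal.ResidueField
        ((algebraMap P x.asIdeal.ResidueField).mapMatrix
          (Matrix.of fun i j => MvPolynomial.pderiv j (F₀ i))).row := (hft x hx).2.1
    rw [Matrix.linearIndependent_rows_iff_isUnit, Matrix.isUnit_iff_isUnit_det,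
      ← RingHom.map_det, Ideal.algebraMap_residueField_eq_zero.2 hmem] at h1
    exact not_isUnit_zero h1
  have hsurj : Function.Surjective (MvPolynomial.map (σ := Fin (c + 1)) ρ) :=
    MvPolynomial.map_surjective ρ hρ
  choose F hF using fun i => hsurj (F₀ i)
  obtain ⟨s', rfl⟩ := hsurj s
  have hdetF : MvPolynomial.map ρ (Matrix.of fun i j => MvPolynomial.pderiv j (F i)).det =
      (Matrix.of fun i j => MvPolynomial.pderiv j (F₀ i)).det := by
    rw [RingHom.map_det]
    congr 1
    refine Matrix.ext fun i j => ?_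
    change MvPolynomial.map ρ (MvPolynomial.pderiv j (F i)) = MvPolynomial.pderiv j (F₀ i)
    rw [← hF, MvPolynomial.pderiv_map]
  have hF0 : (MvPolynomial.map ρ) ∘ F = F₀ := funext hF
  have hFs : (MvPolynomial.map ρ) ∘ (fun i : Fin c => F i.succ) = f := funext fun i => hF i.succ
  have hlift : ∀ {κ : Type} (G : κ → MvPolynomial (Fin (c + 1)) A) (g : MvPolynomial (Fin (c + 1)) A),
      MvPolynomial.map ρ g ∈ Ideal.span (Set.range ((MvPolynomial.map ρ) ∘ G)) →
      g ∈ Ideal.span (Set.range G) ⊔ (RingHom.ker ρ).map MvPolynomial.C := by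
    intro κ G g hg
    rw [Set.range_comp, ← Ideal.map_span] at hg
    rwa [← MvPolynomial.ker_map, RingHom.ker_eq_comap_bot, ← Ideal.comap_map_of_surjective _ hsurj]
  refine ⟨F, s' * (Matrix.of fun i j => MvPolynomial.pderiv j (F i)).det, fun i => ?_, ?_,
    dvd_mul_left _ _, fun q hq hmem => ?_, fun g hg => ?_, fun g hg => ?_⟩
  · rw [hF]; exact hf i
  · rw [hF]; exact ht
  · have hx : q.comap π.toRingHom ∈ TP := Finset.mem_image_of_mem _ hq
    rw [map_mul, map_mul] at hmem
    rcases q.2.mem_or_mem hmem with h | h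
    · exact hs _ hx h
    · rw [hdetF] at h
      exact hdet _ hx h
  · rw [mul_right_comm]
    refine Ideal.mul_mem_right _ _ (hlift _ _ ?_)
    rw [map_mul, hFs]
    exact hsJ _ hg
  · rw [mul_right_comm]
    refine Ideal.mul_mem_right _ _ (hlift _ _ ?_)
    rw [map_mul, hF0]
    exact hsJ' _ hg

/-! ### Cocartesian squares of rings and étale maps -/

/-- A commutative square of rings whose horizontal maps are surjective is cocartesian if the
kernel of the upper one generates that of the lower one. -/
theorem isPushout_of_surjective {R R' S S' : CommRingCat.{u}} {f : R ⟶ R'} {g : R ⟶ S}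
    {f' : S ⟶ S'} {g' : R' ⟶ S'} (w : f ≫ g' = g ≫ f') (hf : Function.Surjective f.hom)
    (hf' : Function.Surjective f'.hom)
    (hker : RingHom.ker f'.hom ≤ (RingHom.ker f.hom).map g.hom) : IsPushout f g g' f' := by
  have hdesc : ∀ s : Limits.PushoutCocone f g, ∃ d : S' ⟶ s.pt, f' ≫ d = s.inr := by
    intro s
    have hle : RingHom.ker f'.hom ≤ RingHom.ker s.inr.hom := by
      refine hker.trans (Ideal.map_le_iff_le_comap.2 fun r hr => ?_)
      have := congrArg (fun φ => φ.hom r) s.condition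
      simp only [CommRingCat.hom_comp, RingHom.comp_apply] at this
      rw [Ideal.mem_comap, RingHom.mem_ker, ← this, RingHom.mem_ker.1 hr, map_zero]
    exact ⟨CommRingCat.ofHom (f'.hom.liftOfSurjective hf' ⟨s.inr.hom, hle⟩),
      CommRingCat.hom_ext (RingHom.liftOfSurjective_comp f'.hom hf' ⟨s.inr.hom, hle⟩)⟩
  choose d hd using hdesc
  have hepi (X : CommRingCat.{u}) (m m' : S' ⟶ X) (h : f' ≫ m = f' ≫ m') : m = m' := by
    ext x
    obtain ⟨y, rfl⟩ := hf' x
    exact congrArg (fun φ => φ.hom y) h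
  refine ⟨⟨w⟩, ⟨Limits.PushoutCocone.IsColimit.mk w d (fun s => ?_) hd
    (fun s m _ h₂ => hepi _ _ _ (h₂.trans (hd s).symm))⟩⟩
  ext r'
  obtain ⟨r, rfl⟩ := hf r'
  have h : f ≫ g' ≫ d s = f ≫ s.inl := by
    rw [reassoc_of% w, hd, s.condition]
  exact congrArg (fun φ => φ.hom r) h

/-- Base change of étale ring homomorphisms along a surjection. -/
theorem etale_of_surjective {R R' S S' : Type u} [CommRing R] [CommRing R'] [CommRing S]
    [CommRing S'] {f : R →+* R'} {g : R →+* S} {f' : S →+* S'} {g' : R' →+* S'}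
    (w : g'.comp f = f'.comp g) (hf : Function.Surjective f) (hf' : Function.Surjective f')
    (hker : RingHom.ker f' ≤ (RingHom.ker f).map g) (hg : g.Etale) : g'.Etale := by
  have h : IsPushout (CommRingCat.ofHom f) (CommRingCat.ofHom g) (CommRingCat.ofHom g')
      (CommRingCat.ofHom f') :=
    isPushout_of_surjective (by ext x; exact congrArg (fun φ : R →+* S' => φ x) w) hf hf' hker
  have h' := isPullback_SpecMap_of_isPushout _ _ _ _ h
  have h₁ : Etale (Spec.map (CommRingCat.ofHom g)) :=
    (HasRingHomProperty.Spec_iff (P := @Etale)).2 hg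
  exact (HasRingHomProperty.Spec_iff (P := @Etale)).1 (MorphismProperty.of_isPullback h'.flip h₁)

section Localization

variable {R S : Type*} [CommRing R] [CommRing S]

theorem ker_awayMap (f : R →+* S) (r : R) : RingHom.ker (Localization.awayMap f r) =
    (RingHom.ker f).map (algebraMap R (Localization.Away r)) :=
  IsLocalization.ker_map (Localization.Away (f r)) f (Submonoid.map_powers f r)

theorem awayMap_surjective (f : R →+* S) (hf : Function.Surjective f) (r : R) :
    Function.Surjective (Localization.awayMap f r) := by
  have : IsLocalization ((Submonoid.powers r).map f) (Localization.Away (f r)) := by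
    rw [Submonoid.map_powers]; infer_instance
  exact IsLocalization.map_surjective_of_surjective (Submonoid.powers r) (Localization.Away r)
    (Localization.Away (f r)) hf

theorem awayMap_algebraMap (f : R →+* S) (r x : R) :
    Localization.awayMap f r (algebraMap R _ x) = algebraMap S _ (f x) :=
  IsLocalization.map_eq _ _

theorem map_away_eq_of_mul_mem (h : R) (K L : Ideal R) (hLK : L ≤ K) (hK : ∀ g ∈ K, h * g ∈ L) :
    K.map (algebraMap R (Localization.Away h)) = L.map (algebraMap R (Localization.Away h)) := by
  refine le_antisymm (Ideal.map_le_iff_le_comap.2 fun g hg => ?_) (Ideal.map_mono hLK)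
  have := Ideal.mem_map_of_mem (algebraMap R (Localization.Away h)) (hK g hg)
  rw [map_mul] at this
  exact (Ideal.unit_mul_mem_iff_mem (Ideal.map (algebraMap R (Localization.Away h)) L)
    (IsLocalization.Away.algebraMap_isUnit h)).1 this

end Localization

theorem ker_constantCoeff_eq_span {σ A : Type*} [CommRing A] :
    RingHom.ker (MvPolynomial.constantCoeff (σ := σ) (R := A)) =
      Ideal.span (Set.range MvPolynomial.X) := by
  refine le_antisymm (fun p hp => ?_) (Ideal.span_le.2 ?_)
  · rw [← Set.image_univ, MvPolynomial.mem_ideal_span_X_image]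
    intro m hm
    by_contra! H
    have : m = 0 := Finsupp.ext fun i => H i trivial
    rw [this, MvPolynomial.mem_support_iff, ← MvPolynomial.constantCoeff_eq] at hm
    exact hm hp
  · rintro _ ⟨i, rfl⟩
    exact MvPolynomial.constantCoeff_X (R := A) i

theorem isUnit_of_dvd_algebraMap {R S : Type*} [CommRing R] [CommRing S] [Algebra R S] {a h : R}
    [IsLocalization.Away h S] (hd : a ∣ h) : IsUnit (algebraMap R S a) :=
  isUnit_of_dvd_unit (map_dvd _ hd) (IsLocalization.Away.algebraMap_isUnit h)

/-- The common zero locus `C` of `F 1, …, F c`, in the open subset of affine space over `A` where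
`h` and the Jacobian determinant of `F` are invertible, is étale over the affine line over `A`
by means of the function `F 0`. -/
theorem etale_quotient_of_pderiv {A : Type u} [CommRing A] {c : ℕ}
    (F : Fin (c + 1) → MvPolynomial (Fin (c + 1)) A) (h : MvPolynomial (Fin (c + 1)) A)
    (hF : (Matrix.of fun i j => MvPolynomial.pderiv j (F i)).det ∣ h) :
    ∃ φ : Polynomial A →+* Localization.Away h ⧸
        (Ideal.span (Set.range fun i : Fin c => F i.succ)).map (algebraMap _ (Localization.Away h)),
      φ.Etale ∧ φ Polynomial.X = Ideal.Quotient.mk _ (algebraMap _ _ (F 0)) ∧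
      ∀ a, φ (Polynomial.C a) = Ideal.Quotient.mk _
        (algebraMap (MvPolynomial (Fin (c + 1)) A) _ (MvPolynomial.C a)) := by
  let D := Localization.Away h
  let I : Ideal D := (Ideal.span (Set.range fun i : Fin c => F i.succ)).map (algebraMap _ D)
  let e := MvPolynomial.finSuccEquiv A c
  -- `F` itself, as an étale map to affine space over the affine line; the claim is its base change
  -- to the zero section of that affine space
  let g : Polynomial (MvPolynomial (Fin c) A) →+* D :=
    ((algebraMap (MvPolynomial (Fin (c + 1)) A) D).comp (MvPolynomial.aeval F :
      MvPolynomial (Fin (c + 1)) A →ₐ[A] MvPolynomial (Fin (c + 1)) A).toRingHom).comp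
      e.symm.toRingEquiv.toRingHom
  have hg : g.Etale := RingHom.Etale.stableUnderComposition _ _
    (RingHom.Etale.of_bijective e.symm.bijective)
    (etale_of_isUnit_det_pderiv F h (isUnit_of_dvd_algebraMap hF))
  have hgX : g Polynomial.X = algebraMap _ D (F 0) := by
    have : e.symm Polynomial.X = MvPolynomial.X 0 := by
      rw [AlgEquiv.symm_apply_eq]; exact MvPolynomial.finSuccEquiv_X_zero.symm
    simp [g, this]
  have hgCX (i : Fin c) : g (Polynomial.C (MvPolynomial.X i)) = algebraMap _ D (F i.succ) := by
    have : e.symm (Polynomial.C (MvPolynomial.X i)) = MvPolynomial.X i.succ := by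
      rw [AlgEquiv.symm_apply_eq]; exact MvPolynomial.finSuccEquiv_X_succ.symm
    simp [g, this]
  have hgC (a : A) : g (Polynomial.C (MvPolynomial.C a)) =
      algebraMap (MvPolynomial (Fin (c + 1)) A) D (MvPolynomial.C a) := by
    have : e.symm (Polynomial.C (MvPolynomial.C a)) = MvPolynomial.C a := e.symm.commutes a
    simp [g, this]
  let f : Polynomial (MvPolynomial (Fin c) A) →+* Polynomial A :=
    Polynomial.mapRingHom MvPolynomial.constantCoeff
  have hf : Function.Surjective f := Polynomial.map_surjective _
    fun a => ⟨MvPolynomial.C a, MvPolynomial.constantCoeff_C _ a⟩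
  have hkf : RingHom.ker f = (Ideal.span (Set.range MvPolynomial.X)).map Polynomial.C := by
    rw [Polynomial.ker_mapRingHom, ker_constantCoeff_eq_span]
  have hmap : (RingHom.ker f).map g = I := by
    rw [hkf, Ideal.map_span, Ideal.map_span, ← Set.range_comp, ← Set.range_comp]
    change _ = Ideal.map _ _
    rw [Ideal.map_span, ← Set.range_comp]
    congr 2
    exact funext hgCX
  have hle : RingHom.ker f ≤ RingHom.ker ((Ideal.Quotient.mk I).comp g) := by
    rw [← RingHom.comap_ker, Ideal.mk_ker, ← Ideal.map_le_iff_le_comap, hmap]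
  refine ⟨f.liftOfSurjective hf ⟨_, hle⟩, ?_, ?_, fun a => ?_⟩
  · refine etale_of_surjective (RingHom.liftOfSurjective_comp f hf ⟨_, hle⟩) hf
      Ideal.Quotient.mk_surjective ?_ hg
    rw [Ideal.mk_ker, hmap]
  · have := congrArg (fun φ => φ Polynomial.X) (RingHom.liftOfSurjective_comp f hf ⟨_, hle⟩)
    simp only [RingHom.comp_apply, f, Polynomial.coe_mapRingHom, Polynomial.map_X] at this
    rw [← hgX]
    exact this
  · have := congrArg (fun φ => φ (Polynomial.C (MvPolynomial.C a)))
      (RingHom.liftOfSurjective_comp f hf ⟨_, hle⟩)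
    simp only [RingHom.comp_apply, f, Polynomial.coe_mapRingHom, Polynomial.map_C,
      MvPolynomial.constantCoeff_C] at this
    rw [← hgC]
    exact this

/-! ### Deformation of a smooth curve with a section -/

/-- A finite set is dominated by the antichain of its maximal elements. -/
theorem exists_finset_maximal {α : Type*} [PartialOrder α] {T : Set α} (hT : T.Finite) :
    ∃ T' : Finset α, IsAntichain (· ≤ ·) (T' : Set α) ∧ (∀ x ∈ T', x ∈ T) ∧
      ∀ x ∈ T, ∃ y ∈ T', x ≤ y := by
  have hfin : {x | Maximal (· ∈ T) x}.Finite := hT.subset fun x hx => hx.prop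
  refine ⟨hfin.toFinset, ?_, fun x hx => ((hfin.mem_toFinset).1 hx).prop, fun x hx => ?_⟩
  · rw [hfin.coe_toFinset]
    exact setOfPred_maximal_antichain _
  · obtain ⟨y, hxy, hy⟩ := hT.exists_le_maximal hx
    exact ⟨y, hfin.mem_toFinset.2 hy, hxy⟩

theorem exists_surjective_mvPolynomial_fin_succ (A B : Type*) [CommRing A] [CommRing B]
    [Algebra A B] [Algebra.FiniteType A B] :
    ∃ (c : ℕ) (π : MvPolynomial (Fin (c + 1)) A →ₐ[A] B), Function.Surjective π := by
  obtain ⟨n, f, hf⟩ := Algebra.FiniteType.iff_quotient_mvPolynomial''.1 ‹Algebra.FiniteType A B›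
  refine ⟨n, MvPolynomial.aeval (Fin.cons 0 fun i => f (MvPolynomial.X i)), fun b => ?_⟩
  obtain ⟨p, rfl⟩ := hf b
  refine ⟨MvPolynomial.rename Fin.succ p, ?_⟩
  rw [MvPolynomial.aeval_rename]
  exact (DFunLike.congr_fun (MvPolynomial.aeval_unique f) p).symm

theorem map_mem_nonZeroDivisors_of_flat {R S : Type*} [CommRing R] [CommRing S] (f : R →+* S)
    (hf : f.Flat) {r : R} (hr : r ∈ nonZeroDivisors R) : f r ∈ nonZeroDivisors S := by
  algebraize [f]
  have h := Module.Flat.isSMulRegular_of_nonZeroDivisors (M := S) hr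
  refine mem_nonZeroDivisors_iff_right.2 fun x hx => h ?_
  change r • x = r • 0
  rw [smul_zero, Algebra.smul_def, mul_comm]
  exact hx

/-- Deformation of a smooth curve with a section. Let `Spec B → Spec A₀` be smooth of relative
dimension one at the points of `T`, with section `σ`, and let `A₀` be a quotient of `A`. On an open
set `b ≠ 0` that contains `T`, the curve and its section extend over `Spec A`: there are a scheme
`Spec C` of finite type over `Spec A` and a principal divisor `Spec W` in it, with equation `t`, such
that `Spec W` is étale over `Spec A`, and whose restrictions to `Spec A₀` are the localization of
`Spec B` at `b` and its intersection with the section. The equation `t` remains a nonzerodivisor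
after any flat extension of `C`. The inclusions of kernels say that the squares are cocartesian. -/
theorem exists_model {A A₀ B : Type u} [CommRing A] [CommRing A₀] [CommRing B]
    [IsNoetherianRing A₀] [Algebra A₀ B] [Algebra.FiniteType A₀ B]
    (ρ : A →+* A₀) (hρ : Function.Surjective ρ) (σ : B →ₐ[A₀] A₀)
    (T : Set (PrimeSpectrum B)) (hT : T.Finite)
    (hsm : ∀ q ∈ T, ∃ b ∉ q.asIdeal,
      Algebra.IsStandardSmoothOfRelativeDimension 1 A₀ (Localization.Away b)) :
    ∃ (b : B) (C W : CommRingCat.{u}) (γ : A →+* C) (w : C →+* W)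
      (υ : C →+* Localization.Away b) (ν : W →+* Localization.Away (σ.toRingHom b)) (t : C),
      (∀ q ∈ T, b ∉ q.asIdeal) ∧ γ.FiniteType ∧
      (∀ (E : Type u) [CommRing E] (e : C →+* E), e.Flat → e t ∈ nonZeroDivisors E) ∧
      (w.comp γ).Etale ∧
      Function.Surjective w ∧ RingHom.ker w = Ideal.span {t} ∧ Function.Surjective υ ∧
      Function.Surjective ν ∧
      υ.comp γ = ((algebraMap B (Localization.Away b)).comp (algebraMap A₀ B)).comp ρ ∧
      RingHom.ker υ ≤ (RingHom.ker ρ).map γ ∧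
      ν.comp w = (Localization.awayMap σ.toRingHom b).comp υ ∧
      RingHom.ker (Localization.awayMap σ.toRingHom b) ≤ (RingHom.ker w).map υ := by
  classical
  -- an open set that contains a point contains its generalizations, so that the specializations
  -- among the points of `T` suffice
  obtain ⟨T', hT', hT'T, hTT'⟩ := exists_finset_maximal hT
  obtain ⟨c, π, hπ⟩ := exists_surjective_mvPolynomial_fin_succ A₀ B
  obtain ⟨F, h, hF, hF0, hdet, hhT, hJ, hJ'⟩ := exists_lift_equations ρ hρ π hπ σ T' hT'
    fun q hq => hsm q (hT'T q hq)
  obtain ⟨φ, hφ, hφX, hφC⟩ := etale_quotient_of_pderiv F h hdet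
  -- `C = D ⧸ (F 1, …, F c)` is étale over `A[X]` by `X ↦ F 0`, and `W = C ⧸ (F 0)`
  let P := MvPolynomial (Fin (c + 1)) A
  let π' : P →+* B := π.toRingHom.comp (MvPolynomial.map ρ)
  have hπ' : Function.Surjective π' := hπ.comp (MvPolynomial.map_surjective ρ hρ)
  have hσ : Function.Surjective σ.toRingHom := fun a => ⟨algebraMap A₀ B a, σ.commutes a⟩
  let D := Localization.Away h
  let b := π' h
  let δ : D →+* Localization.Away b := Localization.awayMap π' h
  let ε : Localization.Away b →+* Localization.Away (σ.toRingHom b) :=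
    Localization.awayMap σ.toRingHom b
  have hδ : Function.Surjective δ := awayMap_surjective π' hπ' h
  have hε : Function.Surjective ε := awayMap_surjective σ.toRingHom hσ b
  let I : Ideal P := Ideal.span (Set.range fun i : Fin c => F i.succ)
  let I' : Ideal P := Ideal.span (Set.range F)
  let N : Ideal P := (RingHom.ker ρ).map MvPolynomial.C
  have hN : N ≤ RingHom.ker π' := by
    refine Ideal.map_le_iff_le_comap.2 fun a ha => ?_
    change π (MvPolynomial.map ρ (MvPolynomial.C a)) = 0
    rw [MvPolynomial.map_C, RingHom.mem_ker.1 ha, MvPolynomial.C_0, map_zero]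
  have hI : I ≤ RingHom.ker π' := by
    refine Ideal.span_le.2 ?_
    rintro _ ⟨i, rfl⟩
    exact hF i
  have hI' : I' ≤ RingHom.ker (σ.toRingHom.comp π') := by
    refine Ideal.span_le.2 ?_
    rintro _ ⟨i, rfl⟩
    refine Fin.cases hF0 (fun i => ?_) i
    change σ (π' (F i.succ)) = 0
    rw [show π' (F i.succ) = 0 from hF i, map_zero]
  have hII' : I ≤ I' := by
    refine Ideal.span_mono ?_
    rintro _ ⟨i, rfl⟩
    exact ⟨i.succ, rfl⟩
  have hI'I : I' ≤ I ⊔ Ideal.span {F 0} := by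
    refine Ideal.span_le.2 ?_
    rintro _ ⟨i, rfl⟩
    refine Fin.cases ?_ (fun i => ?_) i
    · exact Ideal.mem_sup_right (Ideal.mem_span_singleton_self _)
    · exact Ideal.mem_sup_left (Ideal.subset_span ⟨i, rfl⟩)
  have hkπ : (RingHom.ker π').map (algebraMap P D) = (I ⊔ N).map (algebraMap P D) :=
    map_away_eq_of_mul_mem h _ _ (sup_le hI hN) fun g hg => hJ g hg
  have hker' : RingHom.ker π' ≤ RingHom.ker (σ.toRingHom.comp π') := fun g hg => by
    change σ.toRingHom (π' g) = 0
    rw [RingHom.mem_ker.1 hg, map_zero]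
  have hkσ : (RingHom.ker (σ.toRingHom.comp π')).map (algebraMap P D) =
      (I' ⊔ N).map (algebraMap P D) :=
    map_away_eq_of_mul_mem h _ _ (sup_le hI' (hN.trans hker')) fun g hg => hJ' g hg
  have hδP (x : P) : δ (algebraMap P D x) = algebraMap B _ (π' x) := awayMap_algebraMap π' h x
  have hεB (x : B) : ε (algebraMap B _ x) = algebraMap A₀ _ (σ.toRingHom x) :=
    awayMap_algebraMap σ.toRingHom b x
  let ID := I.map (algebraMap P D)
  let ID' := I'.map (algebraMap P D)
  have hID : ID ≤ ID' := Ideal.map_mono hII'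
  have hδI : ID ≤ RingHom.ker δ := by
    rw [ker_awayMap]
    exact Ideal.map_mono hI
  have hεδ : RingHom.ker (ε.comp δ) = (RingHom.ker (σ.toRingHom.comp π')).map (algebraMap P D) := by
    have h₁ : ε.comp δ = Localization.awayMap (σ.toRingHom.comp π') h := by
      refine IsLocalization.ringHom_ext (Submonoid.powers h) (RingHom.ext fun x => ?_)
      exact ((congrArg ε (hδP x)).trans (hεB _)).trans
        (awayMap_algebraMap (σ.toRingHom.comp π') h x).symm
    rw [h₁]
    exact ker_awayMap (σ.toRingHom.comp π') h
  have hδI' : ID' ≤ RingHom.ker (ε.comp δ) := by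
    rw [hεδ]
    exact Ideal.map_mono hI'
  let t : D ⧸ ID := Ideal.Quotient.mk ID (algebraMap P D (F 0))
  let γ : A →+* D ⧸ ID :=
    ((Ideal.Quotient.mk ID).comp (algebraMap P D)).comp MvPolynomial.C
  let υ : D ⧸ ID →+* Localization.Away b := Ideal.Quotient.lift ID δ hδI
  let ν : D ⧸ ID' →+* Localization.Away (σ.toRingHom b) := Ideal.Quotient.lift ID' (ε.comp δ) hδI'
  let w : D ⧸ ID →+* D ⧸ ID' := Ideal.Quotient.factor hID
  have hw : Function.Surjective w := Ideal.Quotient.factor_surjective hID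
  have hkw : RingHom.ker w = Ideal.span {t} := by
    rw [Ideal.Quotient.factor_ker]
    refine le_antisymm ?_ ?_
    · refine (Ideal.map_mono (Ideal.map_mono hI'I)).trans ?_
      rw [Ideal.map_sup, Ideal.map_sup, Ideal.map_quotient_self, bot_sup_eq, Ideal.map_span,
        Ideal.map_span, Set.image_singleton, Set.image_singleton]
    · rw [Ideal.span_singleton_le_iff_mem]
      exact Ideal.mem_map_of_mem _ (Ideal.mem_map_of_mem _ (Ideal.subset_span ⟨0, rfl⟩))
  have hφγ : φ.comp Polynomial.C = γ := RingHom.ext hφC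
  refine ⟨b, .of (D ⧸ ID), .of (D ⧸ ID'), γ, w, υ, ν, t, fun q hq hbq => ?_, ?_,
    fun E _ e he => ?_, ?_, hw, hkw, ?_, ?_, ?_, ?_, ?_, ?_⟩
  · obtain ⟨q', hq', hqq'⟩ := hTT' q hq
    exact hhT q' hq' (hqq' hbq)
  · refine RingHom.FiniteType.comp (RingHom.FiniteType.comp
      (RingHom.FiniteType.of_surjective _ Ideal.Quotient.mk_surjective) ?_) ?_
    · exact (RingHom.finiteType_algebraMap (A := P) (B := D)).2
        (IsLocalization.finiteType_of_monoid_fg (Submonoid.powers h) D)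
    · exact (RingHom.finiteType_algebraMap (A := A) (B := P)).2 inferInstance
  · have hfl : (e.comp φ).Flat :=
      RingHom.Flat.comp (RingHom.Etale.iff_flat_and_formallyUnramified.1 hφ).1 he
    have := map_mem_nonZeroDivisors_of_flat _ hfl (Polynomial.monic_X (R := A)).mem_nonZeroDivisors
    rwa [RingHom.comp_apply, hφX] at this
  · refine etale_of_surjective (f := Polynomial.constantCoeff) (f' := w) (g := φ) ?_ ?_ hw ?_ hφ
    · refine Polynomial.ringHom_ext (fun a => ?_) ?_
      · change w (γ (Polynomial.constantCoeff (Polynomial.C a))) = w (φ (Polynomial.C a))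
        rw [Polynomial.constantCoeff_apply, Polynomial.coeff_C_zero, ← hφγ]
        rfl
      · change w (γ (Polynomial.constantCoeff Polynomial.X)) = w (φ Polynomial.X)
        rw [Polynomial.constantCoeff_apply, Polynomial.coeff_X_zero, map_zero, map_zero, hφX]
        exact (RingHom.mem_ker.1 (hkw ▸ Ideal.mem_span_singleton_self t)).symm
    · exact fun a => ⟨Polynomial.C a, Polynomial.coeff_C_zero⟩
    · rw [hkw, Ideal.span_singleton_le_iff_mem, show t = φ Polynomial.X from hφX.symm]
      exact Ideal.mem_map_of_mem _ (Polynomial.coeff_X_zero)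
  · exact Ideal.Quotient.lift_surjective_of_surjective _ _ hδ
  · exact Ideal.Quotient.lift_surjective_of_surjective _ _ (hε.comp hδ)
  · refine RingHom.ext fun a => ?_
    change δ (algebraMap P D (MvPolynomial.C a)) = algebraMap B _ (algebraMap A₀ B (ρ a))
    rw [hδP]
    change algebraMap B _ (π (MvPolynomial.map ρ (MvPolynomial.C a))) = _
    rw [MvPolynomial.map_C]
    exact congrArg _ (π.commutes _)
  · rw [Ideal.ker_quotient_lift, ker_awayMap, hkπ, Ideal.map_sup, Ideal.map_sup,
      Ideal.map_quotient_self, bot_sup_eq, Ideal.map_map, Ideal.map_map]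
  · exact Ideal.Quotient.ringHom_ext rfl
  · rw [hkw, Ideal.map_span, Set.image_singleton, ker_awayMap]
    have h₁ : RingHom.ker σ.toRingHom = (RingHom.ker (σ.toRingHom.comp π')).map π' := by
      rw [← RingHom.comap_ker, Ideal.map_comap_of_surjective _ hπ']
    rw [h₁, Ideal.map_map, show (algebraMap B (Localization.Away b)).comp π' =
      δ.comp (algebraMap P D) from RingHom.ext fun x => (hδP x).symm, ← Ideal.map_map, hkσ,
      Ideal.map_le_iff_le_comap, Ideal.map_le_iff_le_comap]
    refine sup_le (hI'I.trans (sup_le (fun x hx => ?_) ?_)) (fun x hx => ?_)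
    · change δ (algebraMap P D x) ∈ Ideal.span {υ t}
      rw [hδP, RingHom.mem_ker.1 (hI hx), map_zero]
      exact zero_mem _
    · rw [Ideal.span_singleton_le_iff_mem]
      exact Ideal.mem_span_singleton_self _
    · change δ (algebraMap P D x) ∈ Ideal.span {υ t}
      rw [hδP, RingHom.mem_ker.1 (hN hx), map_zero]
      exact zero_mem _

/-! ### Residue fields and smoothness at a point -/

section Dimension

/-- The canonical map from `A` to the residue field of a point of a scheme over `Spec A`. -/
noncomputable def residueAt {A : CommRingCat.{u}} {X : Scheme.{u}} (f : X ⟶ Spec A) (x : X) :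
    A →+* X.residueField x :=
  ((Scheme.ΓSpecIso A).inv ≫ f.appTop ≫ X.Γevaluation x).hom

theorem residueFieldMap_comp_residueAt {A : CommRingCat.{u}} {X Y : Scheme.{u}} (f : X ⟶ Y)
    (g : Y ⟶ Spec A) (x : X) :
    (f.residueFieldMap x).hom.comp (residueAt g (f x)) = residueAt (f ≫ g) x := by
  simp only [residueAt, ← CommRingCat.hom_comp, Category.assoc, Scheme.Hom.comp_appTop]
  rw [Scheme.Γevaluation_naturality]

theorem residueAt_comp_hom {A A' : CommRingCat.{u}} {X : Scheme.{u}} (f : X ⟶ Spec A)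
    (φ : A' ⟶ A) (x : X) :
    (residueAt f x).comp φ.hom = residueAt (f ≫ Spec.map φ) x := by
  simp only [residueAt, ← CommRingCat.hom_comp, Category.assoc, Scheme.Hom.comp_appTop]
  rw [Scheme.ΓSpecIso_inv_naturality_assoc]

theorem residueAt_eq_zero_iff {A : CommRingCat.{u}} {X : Scheme.{u}} (f : X ⟶ Spec A) (x : X)
    (a : A) : residueAt f x a = 0 ↔ a ∈ (f x).asIdeal := by
  refine (Scheme.evaluation_eq_zero_iff_notMem_basicOpen X x (U := ⊤) trivial
    (f.appTop ((Scheme.ΓSpecIso A).inv a))).trans ?_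
  rw [← Scheme.preimage_basicOpen_top, basicOpen_eq_of_affine]
  exact not_not

theorem exists_residueAt_mul_eq {A : CommRingCat.{u}} (y : Spec A)
    (k : (Spec A).residueField y) : ∃ a s : A, residueAt (𝟙 (Spec A)) y s ≠ 0 ∧
      residueAt (𝟙 (Spec A)) y s * k = residueAt (𝟙 (Spec A)) y a := by
  have := y.isPrime
  let e := Scheme.Spec.residueFieldIso A y
  have hr (a : A) : residueAt (𝟙 (Spec A)) y a =
      e.inv (algebraMap A y.asIdeal.ResidueField a) := by
    refine Eq.trans ?_
      (congrArg (fun φ => φ.hom a) (Scheme.Spec.algebraMap_residueFieldIso_inv A y)).symm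
    change (Spec A).Γevaluation y ((𝟙 (Spec A) : Spec A ⟶ Spec A).appTop _) = _
    rw [Scheme.Hom.id_appTop]
    rfl
  obtain ⟨a, s, hs, h⟩ := IsFractionRing.div_surjective (A := A ⧸ y.asIdeal) (e.hom k)
  obtain ⟨a, rfl⟩ := Ideal.Quotient.mk_surjective a
  obtain ⟨s, rfl⟩ := Ideal.Quotient.mk_surjective s
  refine ⟨a, s, ?_, ?_⟩
  · rw [Ne, residueAt_eq_zero_iff]
    intro H
    exact nonZeroDivisors.ne_zero hs (Ideal.Quotient.eq_zero_iff_mem.2 H)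
  · have hk : k = e.inv (e.hom k) := (e.hom_inv_id_apply k).symm
    rw [hr, hr, hk, ← map_mul, ← h, IsScalarTower.algebraMap_apply A (A ⧸ y.asIdeal),
      IsScalarTower.algebraMap_apply A (A ⧸ y.asIdeal) _ a]
    refine congrArg _ (mul_div_cancel₀ _ ?_)
    exact IsFractionRing.to_map_ne_zero_of_mem_nonZeroDivisors hs

/-- If `x` lies over the generic point of `Spec A`, then the transcendence degree of `κ(x)` over the
residue field of that point is its transcendence degree over `A`. -/
theorem trdeg_residueField_eq {A : CommRingCat.{u}} [IsDomain A] {X : Scheme.{u}} (f : X ⟶ Spec A)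
    (x : X) (hx : (f x).asIdeal = ⊥) :
    letI := (f.residueFieldMap x).hom.toAlgebra
    letI := (residueAt f x).toAlgebra
    Algebra.trdeg ((Spec A).residueField (f x)) (X.residueField x) =
      Algebra.trdeg A (X.residueField x) := by
  algebraize [(residueAt f x), (f.residueFieldMap x).hom, (residueAt (𝟙 (Spec A)) (f x))]
  have : IsScalarTower A ((Spec A).residueField (f x)) (X.residueField x) :=
    .of_algebraMap_eq' (residueFieldMap_comp_residueAt f (𝟙 _) x).symm
  have h₁ : FaithfulSMul A ((Spec A).residueField (f x)) := by
    rw [faithfulSMul_iff_algebraMap_injective, injective_iff_map_eq_zero]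
    intro a ha
    have := (residueAt_eq_zero_iff _ _ _).1 ha
    change a ∈ (f x).asIdeal at this
    rwa [hx] at this
  have h₂ : Algebra.IsAlgebraic A ((Spec A).residueField (f x)) := by
    refine ⟨fun k => ?_⟩
    obtain ⟨a, s, hs, h⟩ := exists_residueAt_mul_eq (f x) k
    refine ⟨Polynomial.C s * Polynomial.X - Polynomial.C a, fun H => hs ?_, ?_⟩
    · have := congrArg (fun p => Polynomial.coeff p 1) H
      simp only [Polynomial.coeff_sub, Polynomial.coeff_C_mul, Polynomial.coeff_X_one, mul_one,
        Polynomial.coeff_C_of_ne_zero one_ne_zero, sub_zero, Polynomial.coeff_zero] at this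
      rw [this, map_zero]
    · simp only [map_sub, map_mul, Polynomial.aeval_C, Polynomial.aeval_X]
      exact sub_eq_zero.2 h
  have h₃ : Algebra.trdeg A ((Spec A).residueField (f x)) = 0 := trdeg_eq_zero
  rw [← trdeg_add_eq A ((Spec A).residueField (f x)), h₃, zero_add]

end Dimension

/-- If `Spec B → Spec A` is smooth of relative dimension `n` on an open subscheme `U`, then every
point of `U` has a neighbourhood of the form `b ≠ 0` on which it is standard smooth. -/
theorem exists_isStandardSmoothOfRelativeDimension_away {A B : CommRingCat.{u}} [Algebra A B] {n : ℕ}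
    {U : Scheme.{u}} (j : U ⟶ Spec B) [IsOpenImmersion j]
    (hU : SmoothOfRelativeDimension n (j ≫ Spec.map (CommRingCat.ofHom (algebraMap A B))))
    (x : Spec B) (hx : x ∈ Set.range j) : ∃ b ∉ x.asIdeal,
      Algebra.IsStandardSmoothOfRelativeDimension n A (Localization.Away b) := by
  obtain ⟨_, ⟨_, ⟨b, rfl⟩, rfl⟩, hxb, hbU⟩ :=
    PrimeSpectrum.isBasis_basic_opens.exists_subset_of_mem_open hx j.isOpenEmbedding.isOpen_range
  let Bb : CommRingCat.{u} := .of (Localization.Away b)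
  let l : Spec Bb ⟶ Spec B := Spec.map (CommRingCat.ofHom (algebraMap B (Localization.Away b)))
  have hl : Set.range l = (PrimeSpectrum.basicOpen b : Set (PrimeSpectrum B)) :=
    PrimeSpectrum.localization_away_comap_range _ b
  have : IsOpenImmersion l := inferInstance
  let m : Spec Bb ⟶ U := IsOpenImmersion.lift j l (hl.trans_subset hbU)
  have hm : m ≫ j = l := IsOpenImmersion.lift_fac _ _ _
  have : IsOpenImmersion m := IsOpenImmersion.of_comp _ j
  have h := HasRingHomProperty.comp_of_isOpenImmersion (P := @SmoothOfRelativeDimension n)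
    (Q := RingHom.Locally (RingHom.IsStandardSmoothOfRelativeDimension n)) m _ hU
  rw [← Category.assoc, hm, ← Spec.map_comp,
    HasRingHomProperty.Spec_iff (P := @SmoothOfRelativeDimension n)] at h
  obtain ⟨s, hs, h⟩ := h
  obtain ⟨y, rfl⟩ : x ∈ Set.range l := hl ▸ hxb
  obtain ⟨t, hts, hty⟩ : ∃ t ∈ s, t ∉ y.asIdeal := by
    by_contra! H
    refine y.isPrime.ne_top (top_le_iff.1 (hs ▸ Ideal.span_le.2 H))
  have h' := h t hts
  refine ⟨b * (IsLocalization.Away.sec b t).1, ?_, ?_⟩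
  · have hb := (IsLocalization.Away.algebraMap_isUnit (S := Localization.Away b) b)
    intro H
    change algebraMap B (Localization.Away b) _ ∈ y.asIdeal at H
    rw [map_mul, ← IsLocalization.Away.sec_spec, map_pow, Ideal.unit_mul_mem_iff_mem _ hb,
      Ideal.mul_unit_mem_iff_mem _ (hb.pow _)] at H
    exact hty H
  · have h₁ := IsLocalization.Away.mul_of_associated (T := Localization.Away t) b _ t
      (IsLocalization.Away.associated_sec_fst b t)
    have h₂ : Algebra.IsStandardSmoothOfRelativeDimension n A (Localization.Away t) := by
      rw [← RingHom.isStandardSmoothOfRelativeDimension_algebraMap]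
      exact h'
    let e := IsLocalization.algEquiv (Submonoid.powers (b * (IsLocalization.Away.sec b t).1))
      (Localization.Away t) (Localization.Away (b * (IsLocalization.Away.sec b t).1))
    exact Algebra.IsStandardSmoothOfRelativeDimension.of_algEquiv _ (e.restrictScalars A)

/-! ### Dimension, principal divisors and images -/

theorem closure_singleton_eq_of_specializes {X : Type*} [TopologicalSpace X] {x y : X}
    (hx : closure {x} ∈ irreducibleComponents X) (h : y ⤳ x) : x ⤳ y := by
  have h₁ : closure {x} ⊆ closure {y} := specializes_iff_closure_subset.1 h
  have h₂ := hx.2 (isIrreducible_singleton.closure (s := {y})) h₁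
  exact specializes_iff_closure_subset.2 h₂

/-- Generalizations lift along flat morphisms, so that generic points lie over the generic point. -/
theorem map_eq_bot_of_flat {A : CommRingCat.{u}} [IsDomain A] {X : Scheme.{u}} (f : X ⟶ Spec A)
    [Flat f] {x : X} (hx : closure {x} ∈ irreducibleComponents X) : (f x).asIdeal = ⊥ := by
  let η : Spec A := (⟨⊥, Ideal.isPrime_bot⟩ : PrimeSpectrum A)
  have h : η ⤳ f x := (PrimeSpectrum.le_iff_specializes η (f x)).1 bot_le
  obtain ⟨x', hx', hx''⟩ := Flat.generalizingMap f h
  have h' : x ⤳ x' := closure_singleton_eq_of_specializes hx hx'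
  have : x = x' := (h'.antisymm hx').eq
  rw [this, hx'']

section

variable {S : Scheme.{u}}

/-- A scheme separated and of finite type over `S`, as an object of `FTSch S`. -/
abbrev FTSch.of {X : Scheme.{u}} (π : X ⟶ S) (h₁ : IsSeparated π) (h₂ : LocallyOfFiniteType π)
    (h₃ : QuasiCompact π) : FTSch S :=
  ⟨Over.mk π, h₁, h₂, h₃⟩

/-- A morphism over `S`, as a morphism of `FTSch S`. -/
abbrev FTSch.homMk {X Y : FTSch S} (f : X.sch ⟶ Y.sch) (h : f ≫ Y.str = X.str) : X ⟶ Y :=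
  ObjectProperty.homMk (Over.homMk f h)

theorem mor_homMk {X Y : FTSch S} (f : X.sch ⟶ Y.sch) (h : f ≫ Y.str = X.str) :
    mor (FTSch.homMk f h) = f := rfl

theorem mor_str {X Y : FTSch S} (f : X ⟶ Y) : mor f ≫ Y.str = X.str := Over.w f.hom

theorem mor_comp {X Y Z : FTSch S} (f : X ⟶ Y) (g : Y ⟶ Z) : mor (f ≫ g) = mor f ≫ mor g := rfl

end

theorem closure_eq_univ_of_asIdeal_eq_bot {A : CommRingCat.{u}} {x : Spec A}
    (hx : x.asIdeal = ⊥) : closure {x} = Set.univ := by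
  refine Set.eq_univ_of_forall fun y => specializes_iff_mem_closure.1 ?_
  refine (PrimeSpectrum.le_iff_specializes x y).1 ?_
  change x.asIdeal ≤ y.asIdeal
  rw [hx]
  exact bot_le

theorem topologicalKrullDim_univ_Spec (R : CommRingCat.{u}) [IsDomain R]
    [IsDiscreteValuationRing R] :
    topologicalKrullDim (Set.univ : Set (Spec R)) = (1 : ℕ) := by
  rw [IsHomeomorph.topologicalKrullDim_eq _ (Homeomorph.Set.univ (Spec R)).isHomeomorph]
  exact (PrimeSpectrum.topologicalKrullDim_eq_ringKrullDim R).trans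
    (IsDiscreteValuationRing.ringKrullDim_eq_one R)

/-- A scheme étale over affine `N`-space over a discrete valuation ring has dimension `N + 1` and
dense image: its generic points lie over the generic point of affine space, and their residue fields
are algebraic over the rational function field. -/
theorem hasPureDim_of_etale {R : CommRingCat.{u}} [IsDomain R] [IsDiscreteValuationRing R] (N : ℕ)
    (X : FTSch (Spec R)) (f : X.sch ⟶ Spec (.of (MvPolynomial (Fin N) R))) [Etale f]
    (hf : f ≫ Spec.map (CommRingCat.ofHom MvPolynomial.C) = X.str) : HasPureDim X (N + 1) 1 := by
  have hC : (CommRingCat.ofHom (MvPolynomial.C (R := R) (σ := Fin N))).hom.Flat :=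
    (RingHom.flat_algebraMap_iff (R := R) (S := MvPolynomial (Fin N) R)).2 inferInstance
  have : Flat (Spec.map (CommRingCat.ofHom (MvPolynomial.C (R := R) (σ := Fin N)))) :=
    (HasRingHomProperty.Spec_iff (P := @Flat)).2 hC
  have : Flat X.str := hf ▸ inferInstance
  intro x hx
  have h₁ : (f x).asIdeal = ⊥ := map_eq_bot_of_flat f hx
  have h₂ : (X.str x).asIdeal = ⊥ := map_eq_bot_of_flat X.str hx
  refine ⟨?_, N, ?_, rfl⟩
  · rw [closure_eq_univ_of_asIdeal_eq_bot h₂]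
    exact topologicalKrullDim_univ_Spec R
  · algebraize [(residueAt f x), (residueAt X.str x), (X.str.residueFieldMap x).hom,
      (f.residueFieldMap x).hom]
    have h₃ : residueTrdeg X x = Algebra.trdeg R (X.sch.residueField x) :=
      trdeg_residueField_eq X.str x h₂
    have h₄ : Algebra.trdeg (MvPolynomial (Fin N) R) (X.sch.residueField x) = 0 := by
      refine (trdeg_residueField_eq f x h₁).symm.trans ?_
      have : Algebra.IsSeparable ((Spec (.of (MvPolynomial (Fin N) R))).residueField (f x))
        (X.sch.residueField x) := inferInstance
      exact trdeg_eq_zero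
    have h₅ : IsScalarTower R (MvPolynomial (Fin N) R) (X.sch.residueField x) := by
      refine .of_algebraMap_eq' ?_
      have := residueAt_comp_hom f (CommRingCat.ofHom (MvPolynomial.C (R := R) (σ := Fin N))) x
      rw [hf] at this
      exact this.symm
    have h₆ : FaithfulSMul (MvPolynomial (Fin N) R) (X.sch.residueField x) := by
      rw [faithfulSMul_iff_algebraMap_injective, injective_iff_map_eq_zero]
      intro a ha
      have := (residueAt_eq_zero_iff _ _ _).1 ha
      rwa [h₁] at this
    rw [h₃, ← trdeg_add_eq R (MvPolynomial (Fin N) R), h₄, add_zero,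
      MvPolynomial.trdeg_of_isDomain]
    simp

theorem isRegularLocalRing_stalk_Spec (A : CommRingCat.{u}) [IsRegularRing A] (x : Spec A) :
    IsRegularLocalRing ((Spec A).presheaf.stalk x) := by
  have := x.isPrime
  exact IsRegularLocalRing.of_ringEquiv (R := Localization.AtPrime x.asIdeal)
    (Spec.stalkIso A x).symm.commRingCatIsoToRingEquiv

theorem flat_appTop_map {X : Scheme.{u}} [IsAffine X] (U : X.affineOpens) :
    (X.presheaf.map (homOfLE (le_top : U.1 ≤ ⊤)).op).hom.Flat := by
  have := Flat.flat_appLE (𝟙 X) (isAffineOpen_top X) U.2 le_top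
  simpa [Scheme.Hom.appLE] using this

theorem ker_ideal_Spec_map {C W : CommRingCat.{u}} (w : C ⟶ W) (t : C)
    (hk : RingHom.ker w.hom = Ideal.span {t}) (U : (Spec C).affineOpens) :
    (Spec.map w).ker.ideal U = Ideal.span {(Spec C).presheaf.map (homOfLE le_top).op
      ((Scheme.ΓSpecIso C).inv t)} := by
  let V : (Spec C).affineOpens := ⟨⊤, isAffineOpen_top _⟩
  have h₁ : (Spec.map w).ker.ideal V = Ideal.span {(Scheme.ΓSpecIso C).inv t} := by
    rw [Scheme.Hom.ker_apply]
    ext z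
    obtain ⟨y, rfl⟩ : ∃ y, (Scheme.ΓSpecIso C).inv y = z :=
      ⟨_, (Scheme.ΓSpecIso C).hom_inv_id_apply z⟩
    have h₂ : (Spec.map w).app ⊤ ((Scheme.ΓSpecIso C).inv y) = (Scheme.ΓSpecIso W).inv (w y) :=
      (congrArg (fun φ => φ.hom y) (Scheme.ΓSpecIso_inv_naturality w)).symm
    have h₃ : y ∈ RingHom.ker w.hom ↔ y ∈ Ideal.span {t} := by rw [hk]
    rw [Ideal.mem_span_singleton] at h₃ ⊢
    have h₄ : (Scheme.ΓSpecIso C).inv t ∣ (Scheme.ΓSpecIso C).inv y ↔ t ∣ y :=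
      map_dvd_iff (Scheme.ΓSpecIso C).symm.commRingCatIsoToRingEquiv
    rw [h₄, ← h₃, RingHom.mem_ker, RingHom.mem_ker]
    refine (Eq.congr_left h₂).trans ?_
    exact map_eq_zero_iff _ (Scheme.ΓSpecIso W).symm.commRingCatIsoToRingEquiv.injective
  rw [← (Spec.map w).ker.map_ideal (U := U) (V := V) (le_top (a := U.1)), h₁, Ideal.map_span,
    Set.image_singleton]
  rfl

/-- The closed subscheme with the equation `t` is a principal divisor, if `t` is a nonzerodivisor in
all flat extensions of `C`; here these are the rings of affine opens of `Spec C`. -/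
theorem isPrincipalDivisor_Spec {C W : CommRingCat.{u}} (w : C ⟶ W) (t : C)
    (hk : RingHom.ker w.hom = Ideal.span {t})
    (ht : ∀ (E : Type u) [CommRing E] (e : C →+* E), e.Flat → e t ∈ nonZeroDivisors E) :
    ∃ t : Γ(Spec C, ⊤), ∀ U : (Spec C).affineOpens,
      (Spec C).presheaf.map (homOfLE le_top).op t ∈ nonZeroDivisors Γ(Spec C, U) ∧
      (Spec.map w).ker.ideal U = Ideal.span {(Spec C).presheaf.map (homOfLE le_top).op t} := by
  refine ⟨(Scheme.ΓSpecIso C).inv t, fun U => ⟨?_, ker_ideal_Spec_map w t hk U⟩⟩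
  exact ht _ (((Spec C).presheaf.map (homOfLE le_top).op).hom.comp (Scheme.ΓSpecIso C).inv.hom)
    (RingHom.Flat.comp (RingHom.Flat.of_bijective
      (Scheme.ΓSpecIso C).symm.commRingCatIsoToRingEquiv.bijective) (flat_appTop_map U))

/-- If the image of `X` is dense in a reduced base `S`, then smoothness over the image is smoothness
over `S`. -/
theorem smoothOverImage_of_dense {S : Scheme.{u}} [IsReduced S] (W X : FTSch S)
    (hX : (imageClosure X : Set S) = Set.univ) (hW : Smooth W.str) : SmoothOverImage W X := by
  let I := Scheme.IdealSheafData.vanishingIdeal (imageClosure X)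
  have : IsIso I.subschemeι := by
    rw [Scheme.isIso_subschemeι_iff_eq_bot]
    have h : imageClosure X = ⊤ := SetLike.coe_injective hX
    simp only [I]
    rw [h, Scheme.IdealSheafData.vanishingIdeal_top,
      Scheme.nilradical_eq_bot]
  exact ⟨W.str ≫ inv I.subschemeι, inferInstance, by simp [I]⟩

/-- A nonempty flat scheme over an integral base hits the generic point, hence so does every scheme
to which it maps. -/
theorem imageClosure_eq_univ {R : CommRingCat.{u}} [IsDomain R] {W X : FTSch (Spec R)}
    (f : W ⟶ X) [Nonempty W.sch] [Flat W.str] : (imageClosure X : Set (Spec R)) = Set.univ := by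
  obtain ⟨x⟩ := ‹Nonempty W.sch›
  let η : Spec R := (⟨⊥, Ideal.isPrime_bot⟩ : PrimeSpectrum R)
  have h : η ⤳ W.str x := (PrimeSpectrum.le_iff_specializes η (W.str x)).1 bot_le
  obtain ⟨x', hx', hx''⟩ := Flat.generalizingMap W.str h
  refine Set.eq_univ_of_univ_subset ?_
  rw [← closure_eq_univ_of_asIdeal_eq_bot (x := η) rfl]
  refine closure_mono (Set.singleton_subset_iff.2 ⟨mor f x', ?_⟩)
  rw [← hx'', ← mor_str f]
  rfl

/-! ### Restriction of homology classes -/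

section

variable {S : Scheme.{u}}

/-- An open subscheme, as an object of `FTSch S`; over a locally Noetherian base its inclusion is
quasi-compact. -/
noncomputable abbrev FTSch.ofOpen [IsLocallyNoetherian S] (X : FTSch S) (O : X.sch.Opens) :
    FTSch S :=
  have := X.property.1
  have := X.property.2.1
  have := X.property.2.2
  have := LocallyOfFiniteType.isLocallyNoetherian X.str
  FTSch.of (O.ι ≫ X.str) inferInstance inferInstance inferInstance

/-- The homology of the empty scheme vanishes, by the localization sequence of the closed immersion
of the empty scheme into itself, with empty complement. -/
theorem subsingleton_homology_of_isEmpty (H : HomologyTheory.{u, w} S) (X : FTSch S)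
    [IsEmpty X.sch] (a n : ℤ) (z : H.H a n X) : z = 0 := by
  let L : ClosedOpen S := ⟨𝟙 X, 𝟙 X, inferInstanceAs (IsClosedImmersion (𝟙 X.sch)),
    inferInstanceAs (IsOpenImmersion (𝟙 X.sch)), by
      ext x
      exact isEmptyElim x⟩
  have h := (H.exact_push_res L a n).apply_apply_eq_zero z
  rwa [H.push_id, H.res_id] at h

/-- Proper push-forward along a closed immersion commutes with restriction to open subschemes. -/
theorem HomologyTheory.res_push_of_cartSq [IsLocallyNoetherian S] (H : HomologyTheory.{u, w} S)
    {P' P : ClosedPair S} (φ : CartSq P' P) (hX : IsOpenImmersion (mor φ.fX))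
    (hX' : Etale (mor φ.fX)) (hY' : Etale (mor φ.fY)) (a n : ℤ) (z : H.H a n P.Y) :
    H.res φ.fX hX' a n (H.push P.i inferInstance a n z) =
      H.push P'.i inferInstance a n (H.res φ.fY hY' a n z) := by
  let O : P.X.sch.Opens :=
    ⟨(Set.range (mor P.i))ᶜ, (mor P.i).isClosedEmbedding.isClosed_range.isOpen_compl⟩
  let L : ClosedOpen S := ⟨P.i, FTSch.homMk (X := P.X.ofOpen O) O.ι rfl, P.closed,
    inferInstanceAs (IsOpenImmersion O.ι), by
      rw [mor_homMk, Scheme.Opens.range_ι]; rfl⟩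
  let O' : P'.X.sch.Opens := mor φ.fX ⁻¹ᵁ O
  have hO' : (O' : Set P'.X.sch) = (Set.range (mor P'.i))ᶜ := by
    rw [show (O' : Set P'.X.sch) = mor φ.fX ⁻¹' (Set.range (mor P.i))ᶜ from rfl,
      Set.preimage_compl, ← Set.image_univ, ← Set.image_univ,
      ← Scheme.image_preimage_eq_of_isPullback φ.isPullback, Set.preimage_univ]
  let L' : ClosedOpen S := ⟨P'.i, FTSch.homMk (X := P'.X.ofOpen O') O'.ι rfl, P'.closed,
    inferInstanceAs (IsOpenImmersion O'.ι), by
      rw [mor_homMk, Scheme.Opens.range_ι]; exact hO'⟩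
  let ψ : L'.Map L := ⟨φ.fX, φ.fY, FTSch.homMk (mor φ.fX ∣_ O) (by
      change (mor φ.fX ∣_ O) ≫ O.ι ≫ P.X.str = O'.ι ≫ P'.X.str
      rw [morphismRestrict_ι_assoc, mor_str]), φ.isPullback, isPullback_morphismRestrict _ O⟩
  exact H.push_res ψ hX hX' hY' a n z

/-- If the fundamental class of `W` dies in `X₂`, then all homology classes of `Z₁` die in `U`. By
duality on `X₁` such a class is `η ∩ α`, its restriction to `V` is the cap product of the
fundamental class of `W` with the pullback of `α`, and by the projection formula its image in `U` is
the cap product of the image of that class in `X₂`. -/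
theorem DualityTheory.res_push_eq_zero [IsLocallyNoetherian S] {τ : ℕ → ℤ}
    (D : DualityTheory.{u, w, w'} S τ) {Z₁ Z₂ X₁ X₂ W U V : FTSch S} {i : Z₁ ⟶ Z₂} {h : Z₁ ⟶ X₁}
    {g : X₂ ⟶ X₁} {f : W ⟶ X₂} {j : U ⟶ Z₂} {k : V ⟶ U} {v : V ⟶ W} {kU : U ⟶ X₂} {q : U ⟶ Z₁}
    [IsClosedImmersion (mor i)] [IsClosedImmersion (mor h)] [IsClosedImmersion (mor f)]
    [IsOpenImmersion (mor j)] [Etale (mor (f ≫ g))]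
    (hU : IsPullback (mor q) (mor kU) (mor h) (mor g))
    (hV : IsPullback (mor k) (mor v) (mor kU) (mor f))
    (hV' : IsPullback (mor (k ≫ q)) (mor k) (mor i) (mor j))
    {d r : ℕ} (hX₁ : HasPureDim X₁ d r) (hX₁' : IsRegularSch X₁) (hW : HasPureDim W d r)
    (hη : D.hom.push f inferInstance _ _ (D.fund W d r hW) = 0) (a n : ℤ) (z : D.hom.H a n Z₁) :
    D.hom.res j inferInstance a n (D.hom.push i inferInstance a n z) = 0 := by
  have hk : IsClosedImmersion (mor k) := MorphismProperty.of_isPullback hV' ‹_›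
  have hkU : IsClosedImmersion (mor kU) := MorphismProperty.of_isPullback hU ‹_›
  have hv : IsClosedImmersion (mor v) := MorphismProperty.of_isPullback hV hkU
  have hjV : IsOpenImmersion (mor (k ≫ q)) := MorphismProperty.of_isPullback hV'.flip ‹_›
  let PZ : ClosedPair S := ⟨h, ‹_›⟩
  let PU : ClosedPair S := ⟨kU, hkU⟩
  let PV : ClosedPair S := ⟨v, hv⟩
  let PW : ClosedPair S := ⟨k, hk⟩
  let Pi : ClosedPair S := ⟨i, ‹_›⟩
  let φU : CartSq PU PZ := ⟨g, q, hU⟩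
  let φV : CartSq PV PU := ⟨f, k, hV⟩
  let φ : CartSq PV PZ := ⟨f ≫ g, k ≫ q, hV.paste_horiz hU⟩
  let ψ : CartSq PW Pi := ⟨j, k ≫ q, hV'⟩
  -- every degree and twist has the form that occurs in Poincaré duality
  obtain ⟨J, rfl⟩ : ∃ J, a = 2 * (d : ℤ) - J := ⟨2 * d - a, by ring⟩
  obtain ⟨N, rfl⟩ : ∃ N, n = (d : ℤ) - τ r - N := ⟨(d : ℤ) - τ r - n, by ring⟩
  obtain ⟨α, rfl⟩ := (D.duality PZ d r hX₁ hX₁' J N).2 z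
  refine (D.hom.res_push_of_cartSq ψ ‹_› inferInstance inferInstance _ _ _).trans ?_
  change D.hom.push k inferInstance _ _ (D.hom.res (k ≫ q) inferInstance _ _ _) = 0
  have h₁ := D.cap_res φ ‹_› inferInstance _ _ J N (D.fund X₁ d r hX₁) α
  have h₂ := D.fund_res (f ≫ g) ‹_› d r hX₁ hW
  have h₃ := D.coh.pull_comp φV φU φ rfl rfl J N α
  have h₄ := D.projection φV inferInstance inferInstance _ _ J N (D.fund W d r hW)
    (D.coh.pull φU J N α)
  rw [h₂, h₃] at h₁
  rw [← h₁]
  refine h₄.symm.trans ?_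
  rw [hη, map_zero, AddMonoidHom.zero_apply]

end

/-! ### Effaceability in the affine model -/

theorem smooth_Spec_map_C (R : CommRingCat.{u}) (N : ℕ) :
    Smooth (Spec.map (CommRingCat.ofHom (MvPolynomial.C (R := R) (σ := Fin N)))) :=
  (HasRingHomProperty.Spec_iff (P := @Smooth)).2
    ((RingHom.smooth_algebraMap (R := R) (S := MvPolynomial (Fin N) R)).2 ⟨inferInstance, inferInstance⟩)

theorem locallyOfFiniteType_Spec_map {A B : CommRingCat.{u}} {φ : A ⟶ B}
    (h : φ.hom.FiniteType) : LocallyOfFiniteType (Spec.map φ) :=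
  (HasRingHomProperty.Spec_iff (P := @LocallyOfFiniteType)).2 h

/-- The algebraic model as given by `exists_model`, turned into cartesian squares of schemes over `R`.
The divisor `W` is smooth over `R`, so that principal triviality kills its fundamental class. -/
theorem res_push_eq_zero_of_ringHom {R : CommRingCat.{u}} [IsDomain R] [IsDiscreteValuationRing R]
    {τ : ℕ → ℤ} (D : DualityTheory.{u, w, w'} (Spec R) τ) (hD : D.PrincipalTriviality)
    {Z₁ Z₂ : FTSch (Spec R)} (i : Z₁ ⟶ Z₂) [IsClosedImmersion (mor i)] (p : Z₂ ⟶ Z₁)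
    {A₀ B : CommRingCat.{u}} (e₁ : Z₁.sch ≅ Spec A₀) (e₂ : Z₂.sch ≅ Spec B)
    {iR : B ⟶ A₀} {pR : A₀ ⟶ B} {rR : R ⟶ A₀} (hi : Spec.map iR = e₁.inv ≫ mor i ≫ e₂.hom)
    (hp : Spec.map pR = e₂.inv ≫ mor p ≫ e₁.hom) (hr : Spec.map rR = e₁.inv ≫ Z₁.str)
    (hpi : pR ≫ iR = 𝟙 A₀) {N : ℕ} {ρ : MvPolynomial (Fin N) R →+* A₀}
    (hρ : Function.Surjective ρ) (hρr : ρ.comp MvPolynomial.C = rR.hom) (b : B)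
    {C W : CommRingCat.{u}} (γ : MvPolynomial (Fin N) R →+* C) (ω : C →+* W)
    (υ : C →+* Localization.Away b) (ν : W →+* Localization.Away (iR.hom b)) (t : C)
    (hγ : γ.FiniteType)
    (ht : ∀ (E : Type u) [CommRing E] (e : C →+* E), e.Flat → e t ∈ nonZeroDivisors E)
    (hωγ : (ω.comp γ).Etale) (hω : Function.Surjective ω) (hωt : RingHom.ker ω = Ideal.span {t})
    (hυ : Function.Surjective υ)
    (hυγ : υ.comp γ = ((algebraMap B (Localization.Away b)).comp pR.hom).comp ρ)
    (hυk : RingHom.ker υ ≤ (RingHom.ker ρ).map γ)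
    (hν : ν.comp ω = (Localization.awayMap iR.hom b).comp υ)
    (hk : RingHom.ker (Localization.awayMap iR.hom b) ≤ (RingHom.ker ω).map υ) :
    ∃ (U : FTSch (Spec R)) (j : U ⟶ Z₂) (_ : IsOpenImmersion (mor j)),
      e₂.inv '' (PrimeSpectrum.basicOpen b : Set (PrimeSpectrum B)) ⊆ Set.range (mor j) ∧
      ∀ (a n : ℤ) (z : D.hom.H a n Z₁),
        D.hom.res j inferInstance a n (D.hom.push i inferInstance a n z) = 0 := by
  let A : CommRingCat.{u} := .of (MvPolynomial (Fin N) R)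
  let Bb : CommRingCat.{u} := .of (Localization.Away b)
  let Vb : CommRingCat.{u} := .of (Localization.Away (iR.hom b))
  let c : R ⟶ A := CommRingCat.ofHom MvPolynomial.C
  let γ' : A ⟶ C := CommRingCat.ofHom γ
  let ω' : C ⟶ W := CommRingCat.ofHom ω
  let υ' : C ⟶ Bb := CommRingCat.ofHom υ
  let ν' : W ⟶ Vb := CommRingCat.ofHom ν
  let ρ' : A ⟶ A₀ := CommRingCat.ofHom ρ
  let ε' : Bb ⟶ Vb := CommRingCat.ofHom (Localization.awayMap iR.hom b)
  let l : B ⟶ Bb := CommRingCat.ofHom (algebraMap B (Localization.Away b))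
  let l₀ : A₀ ⟶ Vb := CommRingCat.ofHom (algebraMap A₀ (Localization.Away (iR.hom b)))
  have hε : Function.Surjective (Localization.awayMap iR.hom b) :=
    awayMap_surjective iR.hom (fun a => ⟨pR a, congrArg (fun φ => φ.hom a) hpi⟩) b
  have hcρ : c ≫ ρ' = rR := CommRingCat.hom_ext hρr
  have hυγ' : γ' ≫ υ' = ρ' ≫ pR ≫ l := CommRingCat.hom_ext hυγ
  have hν' : ω' ≫ ν' = υ' ≫ ε' := CommRingCat.hom_ext hν
  have hl : l ≫ ε' = iR ≫ l₀ := by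
    ext x
    exact awayMap_algebraMap iR.hom b x
  have := smooth_Spec_map_C R N
  have : LocallyOfFiniteType (Spec.map γ') := locallyOfFiniteType_Spec_map hγ
  have : IsClosedImmersion (Spec.map ω') := .spec_of_surjective _ hω
  have : IsClosedImmersion (Spec.map υ') := .spec_of_surjective _ hυ
  have : IsClosedImmersion (Spec.map ρ') := .spec_of_surjective _ hρ
  have : IsClosedImmersion (Spec.map ε') := .spec_of_surjective _ hε
  have : IsOpenImmersion (Spec.map l) :=
    inferInstanceAs (IsOpenImmersion (Spec.map (CommRingCat.ofHom (algebraMap B _))))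
  have := Z₂.property.1
  have := Z₂.property.2.1
  have := Z₂.property.2.2
  let X₁ : FTSch (Spec R) := FTSch.of (Spec.map c) inferInstance inferInstance inferInstance
  let X₂ : FTSch (Spec R) :=
    FTSch.of (Spec.map γ' ≫ Spec.map c) inferInstance inferInstance inferInstance
  let W' : FTSch (Spec R) :=
    FTSch.of (Spec.map ω' ≫ Spec.map γ' ≫ Spec.map c) inferInstance inferInstance inferInstance
  let U : FTSch (Spec R) :=
    FTSch.of (Spec.map l ≫ e₂.inv ≫ Z₂.str) inferInstance inferInstance inferInstance
  let V : FTSch (Spec R) :=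
    FTSch.of (Spec.map ε' ≫ Spec.map l ≫ e₂.inv ≫ Z₂.str) inferInstance inferInstance inferInstance
  have hZ₂ : e₂.inv ≫ Z₂.str = Spec.map pR ≫ Spec.map rR := by
    rw [hp, hr, ← mor_str p]
    simp
  let h : Z₁ ⟶ X₁ := FTSch.homMk (e₁.hom ≫ Spec.map ρ') (by
    change (e₁.hom ≫ Spec.map ρ') ≫ Spec.map c = _
    rw [Category.assoc, ← Spec.map_comp, hcρ, hr, Iso.hom_inv_id_assoc])
  let g : X₂ ⟶ X₁ := FTSch.homMk (Spec.map γ') rfl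
  let f : W' ⟶ X₂ := FTSch.homMk (Spec.map ω') rfl
  let kU : U ⟶ X₂ := FTSch.homMk (Spec.map υ') (by
    change Spec.map υ' ≫ Spec.map γ' ≫ Spec.map c = Spec.map l ≫ e₂.inv ≫ Z₂.str
    rw [hZ₂, ← Spec.map_comp_assoc, hυγ', ← hcρ]
    simp)
  let j : U ⟶ Z₂ := FTSch.homMk (Spec.map l ≫ e₂.inv) (Category.assoc _ _ _)
  let k : V ⟶ U := FTSch.homMk (Spec.map ε') rfl
  let v : V ⟶ W' := FTSch.homMk (Spec.map ν') (by
    change Spec.map ν' ≫ Spec.map ω' ≫ Spec.map γ' ≫ Spec.map c =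
      Spec.map ε' ≫ Spec.map l ≫ e₂.inv ≫ Z₂.str
    rw [← Spec.map_comp_assoc, hν', Spec.map_comp_assoc, ← Spec.map_comp_assoc (γ'), hυγ', hZ₂,
      ← hcρ]
    simp)
  have hj : mor j = Spec.map l ≫ e₂.inv := rfl
  have hjp : mor (j ≫ p) = Spec.map l ≫ Spec.map pR ≫ e₁.inv := by
    rw [mor_comp, hj, hp]
    simp
  have : IsClosedImmersion (mor h) := inferInstanceAs (IsClosedImmersion (e₁.hom ≫ Spec.map ρ'))
  have : IsClosedImmersion (mor f) := inferInstanceAs (IsClosedImmersion (Spec.map ω'))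
  have : IsOpenImmersion (mor j) := inferInstanceAs (IsOpenImmersion (Spec.map l ≫ e₂.inv))
  have hfg : Etale (mor (f ≫ g)) := by
    have : Etale (Spec.map (γ' ≫ ω')) := (HasRingHomProperty.Spec_iff (P := @Etale)).2 hωγ
    rwa [Spec.map_comp] at this
  have sqU : IsPullback (mor (j ≫ p)) (mor kU) (mor h) (mor g) := by
    have := isPullback_SpecMap_of_isPushout _ _ _ _
      (isPushout_of_surjective (f := ρ') (g := γ') (f' := υ') (g' := pR ≫ l) hυγ'.symm hρ hυ hυk)
    refine this.of_iso (Iso.refl _) e₁.symm (Iso.refl _) (Iso.refl _) ?_ ?_ ?_ ?_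
    · rw [hjp]; simp
    · exact (Category.comp_id _).trans (Category.id_comp _).symm
    · exact (Category.comp_id _).trans (e₁.inv_hom_id_assoc _).symm
    · exact (Category.comp_id _).trans (Category.id_comp _).symm
  have sqV : IsPullback (mor k) (mor v) (mor kU) (mor f) :=
    (isPullback_SpecMap_of_isPushout _ _ _ _
      (isPushout_of_surjective (f := ω') (g := υ') (f' := ε') (g' := ν') hν' hω hε hk)).flip
  have sqi : IsPullback (mor (k ≫ j ≫ p)) (mor k) (mor i) (mor j) := by
    have := isPullback_SpecMap_of_isPushout _ _ _ _
      (isPushout_of_surjective (f := iR) (g := l) (f' := ε') (g' := l₀) hl.symm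
        (fun a => ⟨pR a, congrArg (fun φ => φ.hom a) hpi⟩) hε (ker_awayMap iR.hom b).le)
    refine this.of_iso (Iso.refl _) e₁.symm (Iso.refl _) e₂.symm ?_ ?_ ?_ ?_
    · rw [mor_comp, hjp]
      change Spec.map l₀ ≫ e₁.inv = 𝟙 _ ≫ Spec.map ε' ≫ Spec.map l ≫ Spec.map pR ≫ e₁.inv
      rw [← Spec.map_comp_assoc l, hl, Spec.map_comp_assoc, ← Spec.map_comp_assoc pR, hpi]
      simp
    · exact (Category.comp_id _).trans (Category.id_comp _).symm
    · change Spec.map iR ≫ e₂.inv = e₁.inv ≫ mor i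
      rw [hi]
      simp
    · simp [hj]
  have hX₁ : HasPureDim X₁ (N + 1) 1 :=
    have : Etale (𝟙 X₁.sch) := inferInstance
    hasPureDim_of_etale N X₁ (𝟙 X₁.sch) (Category.id_comp _)
  have hW : HasPureDim W' (N + 1) 1 :=
    hasPureDim_of_etale N W' (mor (f ≫ g)) (Category.assoc _ _ _)
  have hreg : IsRegularSch X₁ := fun x => isRegularLocalRing_stalk_Spec A x
  -- the divisor is empty if the section does not meet the open set; otherwise it dominates `Spec R`
  have hη : D.hom.push f inferInstance _ _ (D.fund W' (N + 1) 1 hW) = 0 := by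
    cases isEmpty_or_nonempty W'.sch with
    | inl hempty =>
      rw [subsingleton_homology_of_isEmpty _ W' _ _ (D.fund W' (N + 1) 1 hW), map_zero]
    | inr hne =>
      have hsm : Smooth W'.str := by
        have : Etale (Spec.map ω' ≫ Spec.map γ') := hfg
        have h' : Smooth ((Spec.map ω' ≫ Spec.map γ') ≫ Spec.map c) := inferInstance
        rw [Category.assoc] at h'
        exact h'
      have hcl : (imageClosure X₂ : Set (Spec R)) = Set.univ := imageClosure_eq_univ f
      refine hD ⟨f, ‹_›⟩ (N + 1) 1 hW ?_ (isPrincipalDivisor_Spec ω' t hωt ht)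
        (smoothOverImage_of_dense W' X₂ hcl hsm)
      change topologicalKrullDim (imageClosure X₂ : Set (Spec R)) = _
      rw [hcl]
      exact topologicalKrullDim_univ_Spec R
  refine ⟨U, j, ‹_›, ?_, D.res_push_eq_zero sqU sqV sqi hX₁ hreg hW hη⟩
  rintro _ ⟨y, hy, rfl⟩
  have hy' : y ∈ Set.range (Spec.map l) :=
    (PrimeSpectrum.localization_away_comap_range (Localization.Away b) b).symm ▸ hy
  obtain ⟨x, rfl⟩ := hy'
  exact ⟨x, rfl⟩

end BlochOgus

theorem mainTheorem2 (R : Type u) [CommRing R] [IsDomain R] [IsDiscreteValuationRing R]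
    (_hR : BlochOgus.IsExcellentRing R) (τ : ℕ → ℤ)
    (D : BlochOgus.DualityTheory.{u, w, w'} (Spec (CommRingCat.of R)) τ)
    (hD : D.PrincipalTriviality)
    (Z₁ Z₂ : BlochOgus.FTSch (Spec (CommRingCat.of R))) [IsAffine Z₁.sch] [IsAffine Z₂.sch]
    (i : Z₁ ⟶ Z₂) [IsClosedImmersion (BlochOgus.mor i)] (p : Z₂ ⟶ Z₁) (hp : i ≫ p = 𝟙 Z₁)
    (T : Set Z₂.sch) (hT : T.Finite)
    (hsm : ∀ x ∈ T, BlochOgus.SmoothAtOfRelativeDimension 1 (BlochOgus.mor p) x) :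
    D.hom.EffaceableAt i T := by
  open BlochOgus in
  let A₀ : CommRingCat.{u} := Γ(Z₁.sch, ⊤)
  let B : CommRingCat.{u} := Γ(Z₂.sch, ⊤)
  let e₁ : Z₁.sch ≅ Spec A₀ := Z₁.sch.isoSpec
  let e₂ : Z₂.sch ≅ Spec B := Z₂.sch.isoSpec
  obtain ⟨iR, hiR⟩ := Spec.map_surjective (e₁.inv ≫ mor i ≫ e₂.hom)
  obtain ⟨pR, hpR⟩ := Spec.map_surjective (e₂.inv ≫ mor p ≫ e₁.hom)
  obtain ⟨rR, hrR⟩ := Spec.map_surjective (e₁.inv ≫ Z₁.str)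
  have hip : mor i ≫ mor p = 𝟙 Z₁.sch := congrArg mor hp
  have hpi : pR ≫ iR = 𝟙 A₀ := by
    refine Spec.map_injective ?_
    rw [Spec.map_comp, hiR, hpR, Spec.map_id]
    simp [reassoc_of% hip]
  have := Z₁.property.2.1
  have := Z₂.property.2.1
  have hlp : LocallyOfFiniteType (mor p) := by
    have : LocallyOfFiniteType (mor p ≫ Z₁.str) := (mor_str p).symm ▸ Z₂.property.2.1
    exact locallyOfFiniteType_of_comp _ Z₁.str
  have hpft : pR.hom.FiniteType :=
    (HasRingHomProperty.Spec_iff (P := @LocallyOfFiniteType)).1 (hpR ▸ inferInstance)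
  have hrft : rR.hom.FiniteType :=
    (HasRingHomProperty.Spec_iff (P := @LocallyOfFiniteType)).1 (hrR ▸ inferInstance)
  algebraize [pR.hom]
  obtain ⟨N, ρ, hρ, hρr⟩ : ∃ (N : ℕ) (ρ : MvPolynomial (Fin N) R →+* A₀), Function.Surjective ρ ∧
      ρ.comp MvPolynomial.C = rR.hom := by
    let _ : Algebra R A₀ := rR.hom.toAlgebra
    have : Algebra.FiniteType R A₀ := hrft
    obtain ⟨N, f, hf⟩ := Algebra.FiniteType.iff_quotient_mvPolynomial''.1 this
    exact ⟨N, f.toRingHom, hf, f.comp_algebraMap⟩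
  have : IsNoetherianRing A₀ := isNoetherianRing_of_surjective _ _ ρ hρ
  let σ : B →ₐ[A₀] A₀ := ⟨iR.hom, fun a => congrArg (fun φ => φ.hom a) hpi⟩
  have hsm' : ∀ y ∈ e₂.hom '' T, ∃ b ∉ y.asIdeal,
      Algebra.IsStandardSmoothOfRelativeDimension 1 A₀ (Localization.Away b) := by
    rintro _ ⟨x, hx, rfl⟩
    obtain ⟨O, hxO, hO⟩ := hsm x hx
    refine exists_isStandardSmoothOfRelativeDimension_away (O.ι ≫ e₂.hom) ?_ _ ⟨⟨x, hxO⟩, rfl⟩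
    have h : (O.ι ≫ e₂.hom) ≫ Spec.map pR = (O.ι ≫ mor p) ≫ e₁.hom := by
      rw [hpR]
      simp
    have h' : SmoothOfRelativeDimension (1 + 0) ((O.ι ≫ mor p) ≫ e₁.hom) := inferInstance
    rw [← h] at h'
    exact h'
  obtain ⟨b, C, W, γ, ω, υ, ν, t, hb, hγ, ht, hωγ, hω, hωt, hυ, hν, hυγ, hυk, hνω, hk⟩ :=
    exists_model ρ hρ σ (e₂.hom '' T) (hT.image _) hsm'
  obtain ⟨U, j, hj, hUj, h⟩ := res_push_eq_zero_of_ringHom D hD i p e₁ e₂ hiR hpR hrR hpi hρ hρr b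
    γ ω υ ν t hγ ht hωγ hω hωt hυ hυγ hυk hνω hk
  refine ⟨U, j, hj, fun x hx => hUj ⟨e₂.hom x, hb _ ⟨x, hx, rfl⟩, ?_⟩, h⟩
  simp
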